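/- **Model.** Let $\rho,W>0$, $M\in\{1,2,\dots\}$, $\sigma_M,\sigma_{2M}\in(0,1)$, $\tau\in(0,1)$, $p_s\in(0,1]$; the data transmission duration is $T=1$. The rounds $n=1,2,\dots$ of channel probing are i.i.d. In round $n$ the contention lasts $K_n$ slots of length $\tau$, where $K_n\in\{1,2,\dots\}$ is geometric with parameter $p_s$; independently of it, the successful link has channel gain $h_n\sim\mathcal{CN}(0,1)$ and receives the pilot signals $Y_{n,m}=\sqrt\rho\,h_n+\xi_{n,m}$, $1\le m\le 2M$, with independent noises $\xi_{n,m}\sim\mathcal{CN}(0,1)$. Put $$\hat h_n^{(1)}=\tfrac{\sqrt\rho}{\rho M+1}\sum_{m=1}^{M}Y_{n,m},\qquad \hat h_n^{(2)}=\tfrac{\sqrt\rho}{2\rho M+1}\sum_{m=1}^{2M}Y_{n,m},\qquad R_n^{(1)}=\rho W\sigma_M|\hat h_n^{(1)}|^2,\qquad R_n^{(2)}=\rho W\sigma_{2M}|\hat h_n^{(2)}|^2 .$$ After observing $R_n^{(1)}$, the successful link may transmit at rate $R_n^{(1)}$ for time $1$ ($\phi_n=1$), give up and let all links re-contend ($\phi_n=0$),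 or spend time $\tau$ on second-level probing ($\phi_n=2$) to observe $R_n^{(2)}$, and then either transmit at rate $R_n^{(2)}$ for time $1-\tau$ ($\psi_n=1$) or give up ($\psi_n=0$). Decisions may depend on all that has been observed so far. Let $N$ be the first round with a transmission, $R_N$ and $T_{d,N}$ its rate and duration, and $T_N$ the total system time (contention, second-level probing, data transmission). A strategy is admissible if $N<\infty$ almost surely and $E[T_N]<\infty$. Its throughput is $E[R_NT_{d,N}]/E[T_N]$, $\theta^*$ is the supremum of the throughput over all admissible strategies, and an admissible strategy is optimal if its throughput is maximal. Let $R^{(1)}$ be a random variable with the law of the $R_n^{(1)}$ and $F$ its distribution function, $c_r=\sigma_{2M}/\sigma_M$, $R_e=\sigma_{2M}W\rho\,\frac{M\rho}{(M\rho+1)(2M\rho+1)}$. For $x\ge0$ let $G(\cdot|x)$ be the distribution function of $|\sqrt{c_rx}+z|^2$ with $z\sim\mathcal{CN}(0,R_e)$ (the conditional distribution function of $R_n^{(2)}$ given $R_n^{(1)}=x$), and $J_\theta(x,0)=(1-\tau)\int_\theta^\infty(y-\theta)\,G(dy|x)-\theta\tau$. **Theorem.** Assume $c_r<\frac1{1-\tau}$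 and $\frac{R_e}{\theta^*}e^{-\theta^*/R_e}<\frac{\tau}{1-\tau}$. Then the system $$\int_\theta^\infty(1-G(u|x_J))\,du=\frac{\theta\tau}{1-\tau},\qquad (c_r(1-\tau)-1)x_q+(1-\tau)\Big(R_e+\int_0^\theta G(u|x_q)\,du\Big)=0,$$ $$\int_{x_J}^{x_q}J_\theta(u,0)\,dF(u)+\int_{x_q}^\infty(u-\theta)\,dF(u)=\frac{\theta\tau}{p_s}$$ has at most one solution $(x_J,x_q,\theta)=(x_J,x_q,\theta_A^*)$ with $0\le x_J\le x_q$; the equation $E[R^{(1)}-\theta]^+=\theta\tau/p_s$ has exactly one solution $\theta=\theta_B^*$; and at least one of the following holds. * **Strategy A.** The solution $(x_J,x_q,\theta_A^*)$ exists, and it is optimal in every round $n$ to transmit immediately if $R_n^{(1)}>x_q$, to give up and re-contend if $R_n^{(1)}<x_J$, and to perform second-level probing if $R_n^{(1)}\in[x_J,x_q]$, then transmitting at rate $R_n^{(2)}$ if $R_n^{(2)}>\theta_A^*$ and giving up otherwise. The throughput of this strategy is $\theta_A^*$. * **Strategy B.** It is optimal in every round $n$ never to perform second-level probing, to transmit at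 rate $R_n^{(1)}$ if $R_n^{(1)}>\theta_B^*$, and to give up and re-contend otherwise. The throughput of this strategy is $\theta_B^*$. -/

import Mathlib

open MeasureTheory ProbabilityTheory

noncomputable section

namespace TwoLevelDOS

/-- The circularly symmetric complex Gaussian law `CN(0, s)`, of total variance `s`: the real and
imaginary parts are independent, each of law `N(0, s / 2)`. -/
def complexGaussian (s : ℝ) : Measure ℂ :=
  ((gaussianReal 0 (Real.toNNReal (s / 2))).prod (gaussianReal 0 (Real.toNNReal (s / 2)))).map
    Complex.measurableEquivRealProd.symm

/-- The parameters of the network. The data transmission duration `T` is the unit of time. -/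
structure Params where
  /-- normalized receiver SNR -/
  ρ : ℝ
  /-- bandwidth -/
  W : ℝ
  /-- number of pilot symbols sent in each of the two levels of probing -/
  M : ℕ
  /-- linear rate back-off factor after first-level probing -/
  σ₁ : ℝ
  /-- linear rate back-off factor after second-level probing -/
  σ₂ : ℝ
  /-- duration of a contention slot, and of second-level probing -/
  τ : ℝ
  /-- probability that the contention in a slot is successful -/
  ps : ℝ
  ρ_pos : 0 < ρ
  W_pos : 0 < W
  M_pos : 0 < M
  σ₁_pos : 0 < σ₁
  σ₁_lt : σ₁ < 1
  σ₂_pos : 0 < σ₂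
  σ₂_lt : σ₂ < 1
  τ_pos : 0 < τ
  τ_lt : τ < 1
  ps_pos : 0 < ps
  ps_le : ps ≤ 1

namespace Params

/-- The variance `σ_e²` of the difference of the second-level and the first-level channel
estimate. -/
def σe2 (c : Params) : ℝ := c.M * c.ρ / ((c.M * c.ρ + 1) * (2 * c.M * c.ρ + 1))

/-- The expected relative rate gain `R_e` due to second-level probing. -/
def Re (c : Params) : ℝ := c.σ₂ * c.W * c.ρ * c.σe2

/-- The coefficient `c_r` in `E[R⁽²⁾ | R⁽¹⁾] = c_r R⁽¹⁾ + R_e`. -/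
def cr (c : Params) : ℝ := c.σ₂ / c.σ₁

/-- The law of the number of slots `K ∈ {1, 2, …}` up to and including the first successful
contention. (`geometricMeasure` counts the failures before the first success.) -/
def contentionLaw (c : Params) : Measure ℕ :=
  (geometricMeasure ⟨c.ps, c.ps_pos.le, c.ps_le⟩).map (fun k => k + 1)

/-- The conditional law of `R⁽²⁾` given `R⁽¹⁾ = x`, for `x ≥ 0`: the law of `|√(c_r x) + z|²` with
`z ∼ CN(0, R_e)`, a scaled non-central `χ²` law with two degrees of freedom. -/
def condRate (c : Params) (x : ℝ) : Measure ℝ :=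
  (complexGaussian c.Re).map (fun z => ‖((Real.sqrt (c.cr * x) : ℝ) : ℂ) + z‖ ^ 2)

/-- The conditional distribution function `G(y | x)` of `R⁽²⁾` given `R⁽¹⁾ = x`. -/
def G (c : Params) (y x : ℝ) : ℝ := (c.condRate x).real (Set.Iic y)

/-- The expected net reward `J_θ(x, r)` of second-level probing after observing `R⁽¹⁾ = x`, when
re-contending is worth `r` and the cost per unit of time is `θ`. -/
def J (c : Params) (θ x r : ℝ) : ℝ :=
  r * c.G (r / (1 - c.τ) + θ) x
    + (1 - c.τ) * (∫ y in Set.Ioi (r / (1 - c.τ) + θ), (y - θ) ∂(c.condRate x))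
    - θ * c.τ

end Params

/-- The random signals in the successive rounds of channel probing (rounds are numbered from `0`),
on the probability space `(Ω, P)`. In round `n`: the number `K n` of contention slots, the channel
gain `h n ∼ CN(0, 1)` (Rayleigh fading) of the successful link, and the unit variance receiver
noise `ξ n m` in the `m`-th of the `2M` pilot symbols, the first `M` of which are sent in
first-level and the last `M` in second-level probing. All of these are independent. -/
structure Channel (c : Params) {Ω : Type*} [MeasurableSpace Ω] (P : Measure Ω) where
  K : ℕ → Ω → ℕ
  h : ℕ → Ω → ℂ
  ξ : ℕ → Ω → Fin (2 * c.M) → ℂ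
  measurable_K : ∀ n, Measurable (K n)
  measurable_h : ∀ n, Measurable (h n)
  measurable_ξ : ∀ n, Measurable (ξ n)
  law_round : ∀ n, P.map (fun ω => (K n ω, h n ω, ξ n ω)) =
    c.contentionLaw.prod
      ((complexGaussian 1).prod (Measure.pi (fun _ : Fin (2 * c.M) => complexGaussian 1)))
  indep_rounds : iIndepFun (fun n ω => (K n ω, h n ω, ξ n ω)) P

namespace Channel

variable {c : Params} {Ω : Type*} [MeasurableSpace Ω] {P : Measure Ω}

/-- The received pilot signal `Y = √ρ h X + ξ`, with pilot symbols `X = 1`. -/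
def Y (C : Channel c P) (n : ℕ) (m : Fin (2 * c.M)) (ω : Ω) : ℂ :=
  ((Real.sqrt c.ρ : ℝ) : ℂ) * C.h n ω + C.ξ n ω m

/-- The MMSE estimate of the channel gain after first-level probing (`M` pilot symbols). -/
def hhat1 (C : Channel c P) (n : ℕ) (ω : Ω) : ℂ :=
  ((Real.sqrt c.ρ / (c.ρ * c.M + 1) : ℝ) : ℂ) *
    ∑ m ∈ Finset.univ.filter (fun m : Fin (2 * c.M) => (m : ℕ) < c.M), C.Y n m ω

/-- The MMSE estimate of the channel gain after second-level probing (`2M` pilot symbols). -/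
def hhat2 (C : Channel c P) (n : ℕ) (ω : Ω) : ℂ :=
  ((Real.sqrt c.ρ / (2 * c.ρ * c.M + 1) : ℝ) : ℂ) * ∑ m : Fin (2 * c.M), C.Y n m ω

/-- The transmission rate `R⁽¹⁾` after first-level probing. -/
def R1 (C : Channel c P) (n : ℕ) (ω : Ω) : ℝ := c.ρ * c.W * c.σ₁ * ‖C.hhat1 n ω‖ ^ 2

/-- The transmission rate `R⁽²⁾` after second-level probing. -/
def R2 (C : Channel c P) (n : ℕ) (ω : Ω) : ℝ := c.ρ * c.W * c.σ₂ * ‖C.hhat2 n ω‖ ^ 2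

/-- The law `dF` of the first-level rate `R⁽¹⁾` (the same in every round). -/
def firstRateLaw (C : Channel c P) : Measure ℝ := P.map (C.R1 0)

end Channel

/-- The decisions of a scheduling strategy. In round `n`, `φ n = 1` is to transmit at the
first-level rate, `φ n = 0` is to give up and re-contend, `φ n = 2` is to perform second-level
probing; in the last case, `ψ n = 1` is to transmit at the second-level rate and `ψ n = 0` is to
give up and re-contend. -/
structure Strategy (Ω : Type*) where
  φ : ℕ → Ω → Fin 3
  ψ : ℕ → Ω → Fin 2

namespace Strategy

variable {c : Params} {Ω : Type*} [MeasurableSpace Ω] {P : Measure Ω}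

/-- The information available when `φ n` is chosen: the slot counts and the first-level rates of
rounds `0, …, n`, and the second-level rates of those earlier rounds in which second-level probing
was performed. -/
@[reducible] def info1 (C : Channel c P) (s : Strategy Ω) (n : ℕ) : MeasurableSpace Ω :=
  (⨆ j, ⨆ _ : j ≤ n,
      (MeasurableSpace.comap (C.K j) inferInstance ⊔ MeasurableSpace.comap (C.R1 j) inferInstance)) ⊔
    (⨆ j, ⨆ _ : j < n,
      MeasurableSpace.comap (fun ω => if s.φ j ω = 2 then C.R2 j ω else 0) inferInstance)

/-- The information available when `ψ n` is chosen: moreover the second-level rate of round `n`.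
(`ψ n` is consulted only if second-level probing is performed in round `n`.) -/
@[reducible] def info2 (C : Channel c P) (s : Strategy Ω) (n : ℕ) : MeasurableSpace Ω :=
  info1 C s n ⊔ MeasurableSpace.comap (C.R2 n) inferInstance

/-- The decisions depend on the available information only. -/
def IsAdapted (C : Channel c P) (s : Strategy Ω) : Prop :=
  ∀ n, Measurable[info1 C s n] (s.φ n) ∧ Measurable[info2 C s n] (s.ψ n)

/-- Data are transmitted in round `n`. -/
def Stops (s : Strategy Ω) (n : ℕ) (ω : Ω) : Prop :=
  s.φ n ω = 1 ∨ (s.φ n ω = 2 ∧ s.ψ n ω = 1)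

/-- The stopping rule `N`: the first round in which data are transmitted. -/
def stopRound (s : Strategy Ω) (ω : Ω) : ℕ := sInf {n | s.Stops n ω}

/-- The transmission rate `R_n` in round `n`. -/
def rate (C : Channel c P) (s : Strategy Ω) (n : ℕ) (ω : Ω) : ℝ :=
  (if s.φ n ω = 1 then C.R1 n ω else 0) + (if s.φ n ω = 2 ∧ s.ψ n ω = 1 then C.R2 n ω else 0)

/-- The data transmission duration `T_{d,n}`, in units of `T`. -/
def txTime (c : Params) (s : Strategy Ω) (n : ℕ) (ω : Ω) : ℝ :=
  1 - (if s.φ n ω = 2 ∧ s.ψ n ω = 1 then c.τ else 0)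

/-- The total system time `T_n`: contention time, second-level probing time where it is performed,
and data transmission time. -/
def sysTime (C : Channel c P) (s : Strategy Ω) (n : ℕ) (ω : Ω) : ℝ :=
  (∑ j ∈ Finset.range (n + 1), ((C.K j ω : ℝ) * c.τ + (if s.φ j ω = 2 then c.τ else 0)))
    + s.txTime c n ω

/-- The admissible strategies: data are eventually transmitted and `E[T_N] < ∞`. -/
def IsAdmissible (C : Channel c P) (s : Strategy Ω) : Prop :=
  s.IsAdapted C ∧ (∀ᵐ ω ∂P, ∃ n, s.Stops n ω) ∧
    Integrable (fun ω => s.sysTime C (s.stopRound ω) ω) P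

/-- The throughput (rate of return) `E[R_N T_{d,N}] / E[T_N]`. -/
def throughput (C : Channel c P) (s : Strategy Ω) : ℝ :=
  (∫ ω, s.rate C (s.stopRound ω) ω * s.txTime c (s.stopRound ω) ω ∂P) /
    ∫ ω, s.sysTime C (s.stopRound ω) ω ∂P

/-- The strategy is admissible and maximizes the throughput over all admissible strategies. -/
def IsOptimal (C : Channel c P) (s : Strategy Ω) : Prop :=
  s.IsAdmissible C ∧ ∀ s' : Strategy Ω, s'.IsAdmissible C → s'.throughput C ≤ s.throughput C

end Strategy

section Main

variable {c : Params} {Ω : Type*} [MeasurableSpace Ω] {P : Measure Ω}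

/-- The optimal throughput `θ*`. -/
def optThroughput (C : Channel c P) : ℝ :=
  sSup {v | ∃ s : Strategy Ω, s.IsAdmissible C ∧ s.throughput C = v}

/-- Strategy A with thresholds `xJ`, `xq` for the first-level rate and `θ` for the second-level
rate. -/
def strategyA (C : Channel c P) (xJ xq θ : ℝ) : Strategy Ω where
  φ n ω := if xq < C.R1 n ω then 1 else if C.R1 n ω < xJ then 0 else 2
  ψ n ω := if θ < C.R2 n ω then 1 else 0

/-- Strategy B with threshold `θ`: second-level probing is never performed. -/
def strategyB (C : Channel c P) (θ : ℝ) : Strategy Ω where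
  φ n ω := if θ < C.R1 n ω then 1 else 0
  ψ _ _ := 0

/-- `(xJ, xq, θ)` with `0 ≤ xJ ≤ xq` solves the system of equations of Strategy A. -/
def SolvesA (C : Channel c P) (xJ xq θ : ℝ) : Prop :=
  0 ≤ xJ ∧ xJ ≤ xq ∧
  (∫ u in Set.Ioi θ, (1 - c.G u xJ)) = θ * c.τ / (1 - c.τ) ∧
  (c.cr * (1 - c.τ) - 1) * xq + (1 - c.τ) * (c.Re + ∫ u in (0 : ℝ)..θ, c.G u xq) = 0 ∧
  (∫ u in Set.Icc xJ xq, c.J θ u 0 ∂C.firstRateLaw) + (∫ u in Set.Ioi xq, (u - θ) ∂C.firstRateLaw)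
    = θ * c.τ / c.ps

/-- `θ` solves the equation of Strategy B. -/
def SolvesB (C : Channel c P) (θ : ℝ) : Prop :=
  (∫ ω, max (C.R1 0 ω - θ) 0 ∂P) = θ * c.τ / c.ps

end Main

end TwoLevelDOS

end

set_option linter.unusedSectionVars false

namespace TwoLevelDOS

/-! The ratio problem is linearized by charging a price `θ` per unit of time. Since rounds are
i.i.d. and nothing is carried over after giving up, re-contending is worth `0` at the right price.
That price is fixed by the balance `roundValue C θ = θ * c.τ / c.ps`: the expected best net reward
`max (x - θ) (J_θ(x, 0))⁺` of a round pays exactly for the expected contention time. A solution `θ >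
0` exists because the left side is positive at `0`, nonincreasing and Lipschitz, while the right
side increases strictly from `0`.

At this price no strategy gains more than `θ` times the cost of any round, integrated over the event
that the round is reached (`setIntegral_gain_le`). Summing over rounds bounds every throughput by
`θ` (`IsAdmissible.throughput_le`). A memoryless strategy choosing a best response in every round
turns all these inequalities into equalities, so it is optimal with throughput `θ`
(`IsGreedy.isOptimal`).

It remains to compare `x - θ`, `J_θ(x, 0)` and `0`. On `x ≥ 0`, `J_θ` is strictly increasing
(`J_strictMonoOn`), because the overshoot is convex and even in the amplitude `√(c_r x)` and exceeds
its value at amplitude `0`. The difference `J_θ(x, 0) - (x - θ)` is strictly decreasing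
(`J_sub_strictAntiOn`): its affine part has slope `c_r (1 - τ) - 1 < 0`, and the undershoot
decreases because `R⁽²⁾` grows stochastically with `x`. Hence each threshold is a unique crossing.
If `xJ ≤ xq`, probing is best in between and Strategy A is greedy; if `xq < xJ`, probing never beats
both alternatives and Strategy B is greedy. The hypothesis on `θ*` says `J_θ(0, 0) < 0` at the
optimal price, which makes `J_θ` cross `0` on the half-line.

The conditional law used in `J_θ` is justified by the independence of the first estimate and the
increment to the second (`map_estimates`). -/

/-! ### Complex Gaussian laws: characteristic function, moments, shifts and tails -/

instance isProbabilityMeasure_complexGaussian (s : ℝ) : IsProbabilityMeasure (complexGaussian s) :=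
  Measure.isProbabilityMeasure_map (MeasurableEquiv.measurable _).aemeasurable

lemma integral_complexGaussian {E : Type*} [NormedAddCommGroup E] [NormedSpace ℝ E]
    (s : ℝ) (f : ℂ → E) :
    ∫ z, f z ∂complexGaussian s =
      ∫ p, f (Complex.measurableEquivRealProd.symm p)
        ∂((gaussianReal 0 (Real.toNNReal (s / 2))).prod (gaussianReal 0 (Real.toNNReal (s / 2)))) :=
  integral_map_equiv _ _

lemma charFun_complexGaussian {s : ℝ} (hs : 0 ≤ s) (t : ℂ) :
    charFun (complexGaussian s) t = Complex.exp (-((s * ‖t‖ ^ 2 / 4 : ℝ) : ℂ)) := by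
  have h1 : ∀ u : ℝ, ∫ x : ℝ, Complex.exp (u * x * Complex.I)
      ∂(gaussianReal 0 (Real.toNNReal (s / 2))) = Complex.exp (-((s * u ^ 2 / 4 : ℝ) : ℂ)) := by
    intro u
    rw [← charFun_apply_real, charFun_gaussianReal, Real.coe_toNNReal _ (by positivity)]
    congr 1
    push_cast
    ring
  rw [charFun_apply, integral_complexGaussian]
  have h2 : ∀ p : ℝ × ℝ, Complex.exp ((inner ℝ (Complex.measurableEquivRealProd.symm p) t : ℝ) *
      Complex.I) = Complex.exp (t.re * p.1 * Complex.I) * Complex.exp (t.im * p.2 * Complex.I) := by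
    intro p
    rw [← Complex.exp_add]
    congr 1
    simp [Complex.inner, Complex.measurableEquivRealProd]
    ring
  simp_rw [h2]
  rw [integral_prod_mul (fun x : ℝ => Complex.exp (t.re * x * Complex.I))
    (fun x : ℝ => Complex.exp (t.im * x * Complex.I)), h1, h1, ← Complex.exp_add]
  congr 1
  rw [Complex.sq_norm, Complex.normSq_apply]
  push_cast
  ring

/-- On characteristic functions, multiplication by `a` becomes multiplication of the frequency by
its conjugate, and only the modulus of the frequency matters. This covers both scaling and circular
symmetry. -/
lemma map_mul_complexGaussian {s : ℝ} (hs : 0 ≤ s) (a : ℂ) :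
    (complexGaussian s).map (fun z => a * z) = complexGaussian (‖a‖ ^ 2 * s) := by
  have hm : Measurable (fun z : ℂ => a * z) := by fun_prop
  have := Measure.isProbabilityMeasure_map (μ := complexGaussian s) hm.aemeasurable
  apply Measure.ext_of_charFun
  ext t
  have h : charFun ((complexGaussian s).map (fun z => a * z)) t
      = charFun (complexGaussian s) (star a * t) := by
    rw [charFun_apply, charFun_apply, integral_map hm.aemeasurable
      (Continuous.aestronglyMeasurable (by fun_prop))]
    congr 1
    ext z
    simp only [Complex.inner]
    congr 4
    simp
    ring
  rw [h, charFun_complexGaussian hs, charFun_complexGaussian (by positivity)]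
  simp only [norm_mul, norm_star]
  congr 4
  ring

lemma map_re_complexGaussian (s : ℝ) :
    (complexGaussian s).map Complex.re = gaussianReal 0 (Real.toNNReal (s / 2)) := by
  rw [complexGaussian, Measure.map_map (by fun_prop) (MeasurableEquiv.measurable _)]
  exact Measure.fst_prod

lemma map_im_complexGaussian (s : ℝ) :
    (complexGaussian s).map Complex.im = gaussianReal 0 (Real.toNNReal (s / 2)) := by
  rw [complexGaussian, Measure.map_map (by fun_prop) (MeasurableEquiv.measurable _)]
  exact Measure.snd_prod

lemma sq_gaussianReal {v : NNReal} : ∫ x, x ^ 2 ∂gaussianReal 0 v = v := by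
  have := variance_fun_id_gaussianReal (μ := 0) (v := v)
  rwa [variance_of_integral_eq_zero (by fun_prop) (by simp)] at this

lemma integrable_sq_gaussianReal {v : NNReal} : Integrable (fun x => x ^ 2) (gaussianReal 0 v) :=
  (memLp_id_gaussianReal 2).integrable_sq

lemma integrable_id_gaussianReal {v : NNReal} : Integrable (fun x => x) (gaussianReal 0 v) :=
  (memLp_id_gaussianReal 1).integrable (by simp)

section moments
variable {s : ℝ}

lemma integrable_comp_re {f : ℝ → ℝ}
    (hf : Integrable f (gaussianReal 0 (Real.toNNReal (s / 2)))) :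
    Integrable (fun z : ℂ => f z.re) (complexGaussian s) := by
  rw [← map_re_complexGaussian] at hf
  exact hf.comp_measurable (by fun_prop)

lemma integrable_comp_im {f : ℝ → ℝ}
    (hf : Integrable f (gaussianReal 0 (Real.toNNReal (s / 2)))) :
    Integrable (fun z : ℂ => f z.im) (complexGaussian s) := by
  rw [← map_im_complexGaussian] at hf
  exact hf.comp_measurable (by fun_prop)

lemma integral_comp_re {f : ℝ → ℝ} (hf : Measurable f) :
    ∫ z : ℂ, f z.re ∂complexGaussian s = ∫ x, f x ∂gaussianReal 0 (Real.toNNReal (s / 2)) := by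
  rw [← map_re_complexGaussian, integral_map (by fun_prop) (by fun_prop)]

lemma integral_comp_im {f : ℝ → ℝ} (hf : Measurable f) :
    ∫ z : ℂ, f z.im ∂complexGaussian s = ∫ x, f x ∂gaussianReal 0 (Real.toNNReal (s / 2)) := by
  rw [← map_im_complexGaussian, integral_map (by fun_prop) (by fun_prop)]

lemma sq_norm_ofReal_add (a : ℝ) (z : ℂ) :
    ‖(a : ℂ) + z‖ ^ 2 = a ^ 2 + 2 * a * z.re + z.re ^ 2 + z.im ^ 2 := by
  rw [Complex.sq_norm, Complex.normSq_apply]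
  simp
  ring

lemma integrable_sq_norm_add (a : ℝ) :
    Integrable (fun z : ℂ => ‖(a : ℂ) + z‖ ^ 2) (complexGaussian s) := by
  simp_rw [sq_norm_ofReal_add]
  exact (((integrable_const _).add ((integrable_comp_re integrable_id_gaussianReal).const_mul _)).add
    (integrable_comp_re integrable_sq_gaussianReal)).add
      (integrable_comp_im integrable_sq_gaussianReal)

lemma integral_sq_norm_add (hs : 0 ≤ s) (a : ℝ) :
    ∫ z : ℂ, ‖(a : ℂ) + z‖ ^ 2 ∂complexGaussian s = a ^ 2 + s := by
  simp_rw [sq_norm_ofReal_add]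
  have i0 : Integrable (fun _ : ℂ => a ^ 2) (complexGaussian s) := integrable_const _
  have i1 : Integrable (fun z : ℂ => 2 * a * z.re) (complexGaussian s) :=
    (integrable_comp_re integrable_id_gaussianReal).const_mul _
  have i2 : Integrable (fun z : ℂ => z.re ^ 2) (complexGaussian s) :=
    integrable_comp_re integrable_sq_gaussianReal
  have i3 : Integrable (fun z : ℂ => z.im ^ 2) (complexGaussian s) :=
    integrable_comp_im integrable_sq_gaussianReal
  rw [integral_add (by fun_prop) i3, integral_add (by fun_prop) i2, integral_add i0 i1,
    integral_const_mul, integral_comp_re (f := fun x => x) (by fun_prop),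
    integral_comp_re (f := fun x => x ^ 2) (by fun_prop),
    integral_comp_im (f := fun x => x ^ 2) (by fun_prop), sq_gaussianReal,
    integral_id_gaussianReal, Real.coe_toNNReal _ (by positivity)]
  simp
  ring

end moments

lemma gaussianPDFReal_le_of_abs_le {v : NNReal} {a b t : ℝ} (h : |t - a| ≤ |t - b|) :
    gaussianPDFReal b v t ≤ gaussianPDFReal a v t := by
  unfold gaussianPDFReal
  have := sq_le_sq.mpr h
  gcongr

/-- The difference `D` of the densities centred at `a` and `b` is antisymmetric about the midpoint
and nonnegative to its left. Since `a + b ≥ 0`, the point left of the midpoint in each reflected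
pair has the smaller modulus, so `k` is larger there. -/
lemma integral_gaussianReal_shift_le {v : NNReal} (hv : v ≠ 0) {k : ℝ → ℝ} (hk : Measurable k)
    {B : ℝ} (hB : ∀ t, |k t| ≤ B) (hmono : ∀ t t', |t'| ≤ |t| → k t ≤ k t') {a b : ℝ}
    (ha : 0 ≤ a) (hab : a ≤ b) :
    ∫ x, k (b + x) ∂gaussianReal 0 v ≤ ∫ x, k (a + x) ∂gaussianReal 0 v := by
  have key : ∀ m : ℝ, ∫ x, k (m + x) ∂gaussianReal 0 v = ∫ t, gaussianPDFReal m v t * k t := by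
    intro m
    have h1 := gaussianReal_map_const_add (μ := 0) (v := v) m
    rw [zero_add] at h1
    have h2 := integral_gaussianReal_eq_integral_smul (f := k) (μ := m) hv
    rw [← h1, integral_map (by fun_prop) (by fun_prop)] at h2
    simpa using h2
  have hint : ∀ m : ℝ, Integrable (fun t => gaussianPDFReal m v t * k t) := fun m =>
    (integrable_gaussianPDFReal m v).mul_bdd (c := B) (by fun_prop) (by simpa using .of_forall hB)
  set D : ℝ → ℝ := fun t => gaussianPDFReal a v t - gaussianPDFReal b v t with hD
  have hDk : Integrable (fun t => D t * k t) := by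
    simp only [hD, sub_mul]
    exact (hint a).sub (hint b)
  have hanti : ∀ t, D (a + b - t) = - D t := by
    intro t
    simp only [hD, gaussianPDFReal]
    rw [show a + b - t - a = -(t - b) by ring, show a + b - t - b = -(t - a) by ring, neg_sq, neg_sq]
    ring
  have hI : ∫ t, D t * k t = ∫ t, - D t * k (a + b - t) := by
    rw [← integral_sub_left_eq_self (fun t => D t * k t) volume (a + b)]
    simp only [hanti]
  have hDk' : Integrable (fun t => - D t * k (a + b - t)) := by
    have := (integrable_comp_sub_left (fun t => D t * k t) (a + b)).mpr hDk
    simpa only [hanti] using this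
  -- Reflecting one of the two copies leaves the integrand `D t * (k t - k (a + b - t))`, a product
  -- of two factors of equal sign.
  have h2 : 0 ≤ (∫ t, D t * k t) + ∫ t, D t * k t := by
    nth_rewrite 2 [hI]
    rw [← integral_add hDk hDk']
    apply integral_nonneg
    intro t
    have : D t * k t + -D t * k (a + b - t) = D t * (k t - k (a + b - t)) := by ring
    simp only [this, Pi.zero_apply]
    rcases le_total t ((a + b) / 2) with ht | ht
    · apply mul_nonneg
      · exact sub_nonneg.mpr (gaussianPDFReal_le_of_abs_le (by
          rw [abs_le, abs_of_nonpos (by linarith : t - b ≤ 0)]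
          constructor <;> linarith))
      · exact sub_nonneg.mpr (hmono _ _ (by
          rw [abs_of_nonneg (by linarith : 0 ≤ a + b - t), abs_le]
          constructor <;> linarith))
    · apply mul_nonneg_of_nonpos_of_nonpos
      · exact sub_nonpos.mpr (gaussianPDFReal_le_of_abs_le (by
          rw [abs_le, abs_of_nonneg (by linarith : 0 ≤ t - a)]
          constructor <;> linarith))
      · exact sub_nonpos.mpr (hmono _ _ (by
          rw [abs_of_nonneg (by linarith : 0 ≤ t), abs_le]
          constructor <;> linarith))
  have h3 : ∫ t, D t * k t = (∫ t, gaussianPDFReal a v t * k t) -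
      ∫ t, gaussianPDFReal b v t * k t := by
    rw [← integral_sub (hint a) (hint b)]
    simp only [hD, sub_mul]
  rw [key, key]
  linarith

/-- For a fixed imaginary part `y`, the function `g (t ^ 2 + y ^ 2)` decreases in `|t|`, so the
one-dimensional shift inequality applies to the real part. This is the stochastic monotonicity of a
non-central `χ²` law in its non-centrality. -/
lemma integral_antitone_sq_norm_add_le {s : ℝ} (hs : 0 < s) {g : ℝ → ℝ} (hg : Antitone g)
    {B : ℝ} (hB : ∀ t, |g t| ≤ B) {a b : ℝ} (ha : 0 ≤ a) (hab : a ≤ b) :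
    ∫ z : ℂ, g (‖(b : ℂ) + z‖ ^ 2) ∂complexGaussian s ≤
      ∫ z : ℂ, g (‖(a : ℂ) + z‖ ^ 2) ∂complexGaussian s := by
  have hgm : Measurable g := hg.measurable
  have hbd : ∀ {α : Type} [MeasurableSpace α] (μ : Measure α) [IsProbabilityMeasure μ]
      (f : α → ℝ), Measurable f → Integrable (fun x => g (f x)) μ := fun μ _ f hf =>
    Integrable.of_bound (hgm.comp hf).aestronglyMeasurable B (.of_forall fun x => hB _)
  have key : ∀ m : ℝ, ∫ z : ℂ, g (‖(m : ℂ) + z‖ ^ 2) ∂complexGaussian s =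
      ∫ y, ∫ x, g ((m + x) ^ 2 + y ^ 2) ∂gaussianReal 0 (Real.toNNReal (s / 2))
        ∂gaussianReal 0 (Real.toNNReal (s / 2)) := by
    intro m
    rw [integral_complexGaussian, integral_prod_symm _ (hbd _ _ (by fun_prop))]
    congr 1; ext y; congr 1; ext x
    rw [sq_norm_ofReal_add]
    simp only [Complex.measurableEquivRealProd_symm_apply]
    ring_nf
  have hi : ∀ m : ℝ, Integrable (fun y => ∫ x, g ((m + x) ^ 2 + y ^ 2)
      ∂gaussianReal 0 (Real.toNNReal (s / 2))) (gaussianReal 0 (Real.toNNReal (s / 2))) := fun m =>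
    (hbd ((gaussianReal 0 (Real.toNNReal (s / 2))).prod (gaussianReal 0 (Real.toNNReal (s / 2))))
      (fun p => (m + p.2) ^ 2 + p.1 ^ 2) (by fun_prop)).integral_prod_left
  rw [key, key]
  refine integral_mono (hi b) (hi a) fun y => ?_
  refine integral_gaussianReal_shift_le (k := fun t => g (t ^ 2 + y ^ 2)) (by positivity)
    (by fun_prop) (fun t => hB _) (fun t t' h => hg ?_) ha hab
  have := sq_le_sq.mpr h
  linarith

lemma complexGaussian_tail {s u : ℝ} (hs : 0 < s) (hu : 0 ≤ u) :
    (complexGaussian s).real {z : ℂ | u < ‖z‖ ^ 2} = Real.exp (-(u / s)) := by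
  have hS : MeasurableSet {z : ℂ | u < ‖z‖ ^ 2} := measurableSet_lt (by fun_prop) (by fun_prop)
  have hv : Real.toNNReal (s / 2) ≠ 0 := by positivity
  rw [← integral_indicator_one hS, integral_complexGaussian, gaussianReal_of_var_ne_zero _ hv,
    prod_withDensity (by fun_prop) (by fun_prop),
    integral_withDensity_eq_integral_toReal_smul (by fun_prop)
      (.of_forall fun p => ENNReal.mul_lt_top gaussianPDF_lt_top gaussianPDF_lt_top),
    ← Measure.volume_eq_prod, ← integral_comp_polarCoord_symm]
  -- In polar coordinates the density splits into a radial factor, whose antiderivative is `-exp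
  -- (-(r ^ 2 / s))`, and the uniform density `1 / (2π)` of the angle.
  have hpt : ∀ p ∈ polarCoord.target, p.1 • ((gaussianPDF 0 (Real.toNNReal (s / 2))
      (polarCoord.symm p).1 * gaussianPDF 0 (Real.toNNReal (s / 2)) (polarCoord.symm p).2).toReal •
      Set.indicator {z : ℂ | u < ‖z‖ ^ 2} (1 : ℂ → ℝ)
        (Complex.measurableEquivRealProd.symm (polarCoord.symm p))) =
      (Set.indicator (Set.Ioi (Real.sqrt u))
        (fun r => 2 * r / s * Real.exp (-(r ^ 2 / s))) p.1) * (2 * Real.pi)⁻¹ := by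
    rintro ⟨r, φ⟩ hp
    have hr : 0 < r := hp.1
    have hn : ‖Complex.measurableEquivRealProd.symm (polarCoord.symm (r, φ))‖ = r := by
      rw [Complex.measurableEquivRealProd_symm_polarCoord_symm_apply,
        Complex.norm_polarCoord_symm, abs_of_pos hr]
    by_cases h : Real.sqrt u < r
    · have h' : Complex.measurableEquivRealProd.symm (polarCoord.symm (r, φ)) ∈
          {z : ℂ | u < ‖z‖ ^ 2} := by
        rw [Set.mem_ofPred_eq, hn]
        exact (Real.sqrt_lt' hr).mp h
      rw [Set.indicator_of_mem h', Set.indicator_of_mem (show r ∈ Set.Ioi (Real.sqrt u) from h)]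
      rw [ENNReal.toReal_mul, toReal_gaussianPDF, toReal_gaussianPDF]
      simp only [gaussianPDFReal, Real.coe_toNNReal _ (show 0 ≤ s / 2 by positivity),
        polarCoord_symm_apply, smul_eq_mul, Pi.one_apply]
      have h3 : Real.exp (-(r ^ 2 / s)) = Real.exp (-(r * Real.cos φ - 0) ^ 2 / (2 * (s / 2))) *
          Real.exp (-(r * Real.sin φ - 0) ^ 2 / (2 * (s / 2))) := by
        rw [← Real.exp_add]
        congr 1
        have := Real.sin_sq_add_cos_sq φ
        field_simp
        linear_combination (r ^ 2) * this
      have h4 : (Real.sqrt (2 * Real.pi * (s / 2)))⁻¹ * (Real.sqrt (2 * Real.pi * (s / 2)))⁻¹ =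
          (Real.pi * s)⁻¹ := by
        rw [← mul_inv, Real.mul_self_sqrt (by positivity)]
        congr 1; ring
      rw [h3]
      calc _ = r * ((Real.sqrt (2 * Real.pi * (s / 2)))⁻¹ * (Real.sqrt (2 * Real.pi * (s / 2)))⁻¹) *
            (Real.exp (-(r * Real.cos φ - 0) ^ 2 / (2 * (s / 2))) *
            Real.exp (-(r * Real.sin φ - 0) ^ 2 / (2 * (s / 2)))) := by ring
        _ = _ := by
          rw [h4]
          field_simp
    · have h' : Complex.measurableEquivRealProd.symm (polarCoord.symm (r, φ)) ∉
          {z : ℂ | u < ‖z‖ ^ 2} := by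
        rw [Set.mem_ofPred_eq, hn]
        exact fun h2 => h ((Real.sqrt_lt' hr).mpr h2)
      rw [Set.indicator_of_notMem h', Set.indicator_of_notMem (show r ∉ Set.Ioi (Real.sqrt u) from h)]
      simp
  have hI : ∫ r in Set.Ioi (Real.sqrt u), 2 * r / s * Real.exp (-(r ^ 2 / s)) =
      Real.exp (-(u / s)) := by
    have hd : ∀ r : ℝ, HasDerivAt (fun r => -Real.exp (-(r ^ 2 / s)))
        (2 * r / s * Real.exp (-(r ^ 2 / s))) r := by
      intro r
      have := ((((hasDerivAt_id r).pow 2).div_const s).neg.exp).neg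
      convert! this using 1
      simp
      ring
    have ht : Filter.Tendsto (fun r : ℝ => -Real.exp (-(r ^ 2 / s))) Filter.atTop (nhds 0) := by
      rw [← neg_zero]
      refine (Real.tendsto_exp_neg_atTop_nhds_zero.comp ?_).neg
      exact (Filter.tendsto_pow_atTop (by norm_num)).atTop_div_const hs
    rw [integral_Ioi_of_hasDerivAt_of_nonneg' (fun r _ => hd r) (fun r hr => ?_) ht,
      Real.sq_sqrt hu]
    · ring
    · have : 0 ≤ r := (Real.sqrt_nonneg u).trans (le_of_lt hr)
      positivity
  rw [setIntegral_congr_fun polarCoord.open_target.measurableSet hpt, polarCoord_target,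
    Measure.volume_eq_prod, setIntegral_prod_mul
      (fun r => Set.indicator (Set.Ioi (Real.sqrt u))
        (fun r => 2 * r / s * Real.exp (-(r ^ 2 / s))) r) (fun _ => (2 * Real.pi)⁻¹),
    setIntegral_indicator measurableSet_Ioi, Set.inter_eq_self_of_subset_right
      (Set.Ioi_subset_Ioi (Real.sqrt_nonneg u)), hI]
  simp [Real.pi_pos.le]
  field_simp
  norm_num

/-! ### Overshoot and undershoot of the second-level rate -/

namespace Params
variable (c : Params)

lemma σe2_pos : 0 < c.σe2 := by
  have h1 := c.ρ_pos
  have h2 : (0 : ℝ) < c.M := by exact_mod_cast c.M_pos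
  unfold σe2
  positivity

lemma Re_pos : 0 < c.Re :=
  mul_pos (mul_pos (mul_pos c.σ₂_pos c.W_pos) c.ρ_pos) c.σe2_pos

lemma cr_pos : 0 < c.cr := div_pos c.σ₂_pos c.σ₁_pos

lemma one_sub_τ_pos : 0 < 1 - c.τ := sub_pos.mpr c.τ_lt

instance isProbabilityMeasure_condRate (x : ℝ) : IsProbabilityMeasure (c.condRate x) :=
  Measure.isProbabilityMeasure_map (by fun_prop)

lemma integral_condRate {f : ℝ → ℝ} (hf : Measurable f) (x : ℝ) :
    ∫ y, f y ∂c.condRate x =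
      ∫ z, f (‖((Real.sqrt (c.cr * x) : ℝ) : ℂ) + z‖ ^ 2) ∂complexGaussian c.Re :=
  integral_map (by fun_prop) hf.aestronglyMeasurable

lemma integrable_id_condRate (x : ℝ) : Integrable (fun y => y) (c.condRate x) :=
  (integrable_map_measure (by fun_prop) (by fun_prop)).mpr (integrable_sq_norm_add _)

lemma integral_id_condRate {x : ℝ} (hx : 0 ≤ x) : ∫ y, y ∂c.condRate x = c.cr * x + c.Re := by
  rw [c.integral_condRate (f := fun y => y) measurable_id, integral_sq_norm_add c.Re_pos.le,
    Real.sq_sqrt (mul_nonneg c.cr_pos.le hx)]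

lemma ae_nonneg_condRate (x : ℝ) : ∀ᵐ y ∂c.condRate x, 0 ≤ y :=
  (ae_map_iff (by fun_prop) (measurableSet_le (by fun_prop) (by fun_prop))).mpr
    (.of_forall fun _ => by positivity)

/-- The expected excess `E[(R⁽²⁾ - θ)⁺ | R⁽¹⁾ = x]`. -/
noncomputable def overshoot (θ x : ℝ) : ℝ := ∫ y, max (y - θ) 0 ∂c.condRate x

/-- The expected shortfall `E[(θ - R⁽²⁾)⁺ | R⁽¹⁾ = x]`. -/
noncomputable def undershoot (θ x : ℝ) : ℝ := ∫ y, max (θ - y) 0 ∂c.condRate x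

lemma integrable_overshoot (θ x : ℝ) : Integrable (fun y => max (y - θ) 0) (c.condRate x) :=
  ((c.integrable_id_condRate x).sub (integrable_const θ)).pos_part

lemma integrable_undershoot (θ x : ℝ) : Integrable (fun y => max (θ - y) 0) (c.condRate x) :=
  ((integrable_const θ).sub (c.integrable_id_condRate x)).pos_part

lemma J_eq (θ x : ℝ) : c.J θ x 0 = (1 - c.τ) * c.overshoot θ x - θ * c.τ := by
  have : ∫ y in Set.Ioi θ, (y - θ) ∂c.condRate x = c.overshoot θ x := by
    rw [overshoot, ← integral_indicator measurableSet_Ioi]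
    congr 1
    ext y
    by_cases h : θ < y
    · rw [Set.indicator_of_mem (Set.mem_Ioi.mpr h), max_eq_left (by linarith)]
    · rw [Set.indicator_of_notMem (by simpa using h), max_eq_right (by linarith)]
  simp [J, this]

/-- A positive part is the quantity plus its negative part, and the mean of the rate is affine in
`x`. All nonlinearity is thereby moved to the bounded, antitone undershoot. -/
lemma overshoot_eq_add_undershoot (θ : ℝ) {x : ℝ} (hx : 0 ≤ x) :
    c.overshoot θ x = c.cr * x + c.Re - θ + c.undershoot θ x := by
  rw [← c.integral_id_condRate hx]
  have h1 : ∫ y, (y - θ) ∂c.condRate x = ∫ y, y ∂c.condRate x - θ := by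
    rw [integral_sub (c.integrable_id_condRate x) (integrable_const θ)]
    simp
  have h2 : Integrable (fun y => y - θ) (c.condRate x) :=
    (c.integrable_id_condRate x).sub (integrable_const θ)
  rw [← h1, overshoot, undershoot, ← integral_add h2 (c.integrable_undershoot θ x)]
  congr 1
  ext y
  rcases le_total y θ with h | h
  · rw [max_eq_right (by linarith), max_eq_left (by linarith)]; ring
  · rw [max_eq_left (by linarith), max_eq_right (by linarith)]; ring

lemma undershoot_antitoneOn (θ : ℝ) : AntitoneOn (c.undershoot θ) (Set.Ici 0) := by
  intro x hx y _ hxy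
  -- Truncating at `0` makes the function bounded by `|θ|` and changes nothing on the values of a
  -- squared norm.
  have hg : Antitone (fun y : ℝ => max (θ - max y 0) 0) := by
    intro a b hab
    dsimp only
    gcongr
  have hm : Measurable (fun y : ℝ => max (θ - y) 0) := by fun_prop
  simp only [undershoot]
  rw [c.integral_condRate hm, c.integral_condRate hm]
  have := integral_antitone_sq_norm_add_le c.Re_pos hg (B := |θ|) (fun t => ?_)
    (Real.sqrt_nonneg (c.cr * x)) (Real.sqrt_le_sqrt (mul_le_mul_of_nonneg_left hxy c.cr_pos.le))
  · simpa only [max_eq_left (sq_nonneg _)] using this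
  · rw [abs_of_nonneg (le_max_right _ _)]
    exact max_le (by have := le_max_right t 0; have := le_abs_self θ; linarith) (abs_nonneg _)

lemma undershoot_nonneg (θ x : ℝ) : 0 ≤ c.undershoot θ x :=
  integral_nonneg fun _ => le_max_right _ _

lemma overshoot_nonneg (θ x : ℝ) : 0 ≤ c.overshoot θ x :=
  integral_nonneg fun _ => le_max_right _ _

lemma undershoot_le {θ : ℝ} (hθ : 0 ≤ θ) (x : ℝ) : c.undershoot θ x ≤ θ := by
  have : ∫ y, θ ∂c.condRate x = θ := by simp
  rw [← this, undershoot]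
  refine integral_mono_ae (by simpa using c.integrable_undershoot θ x) (integrable_const θ) ?_
  filter_upwards [c.ae_nonneg_condRate x] with y hy
  simp [hθ, hy]

lemma overshoot_antitone (x : ℝ) : Antitone (fun θ => c.overshoot θ x) := by
  intro a b hab
  exact integral_mono (c.integrable_overshoot _ _) (c.integrable_overshoot _ _)
    fun y => max_le_max_right 0 (by linarith)

lemma overshoot_sub_le (x : ℝ) {a b : ℝ} (hab : a ≤ b) :
    c.overshoot a x ≤ c.overshoot b x + (b - a) := by
  have : ∫ y, (max (y - b) 0 + (b - a)) ∂c.condRate x = c.overshoot b x + (b - a) := by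
    rw [integral_add (c.integrable_overshoot _ _) (integrable_const _)]
    simp [overshoot]
  rw [← this]
  refine integral_mono (c.integrable_overshoot _ _)
    ((c.integrable_overshoot _ _).add (integrable_const _)) fun y => ?_
  have := le_max_left (y - b) 0
  have := le_max_right (y - b) 0
  exact max_le (by linarith) (by linarith)

/-- `E[(|a + z|² - θ)⁺]` for `z ∼ CN(0, R_e)`. -/
noncomputable def shiftedOvershoot (θ a : ℝ) : ℝ :=
  ∫ z, max (‖(a : ℂ) + z‖ ^ 2 - θ) 0 ∂complexGaussian c.Re

lemma overshoot_eq_shifted (θ x : ℝ) :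
    c.overshoot θ x = c.shiftedOvershoot θ (Real.sqrt (c.cr * x)) :=
  c.integral_condRate (f := fun y => max (y - θ) 0) (by fun_prop) x

lemma integrable_shifted (θ a : ℝ) :
    Integrable (fun z : ℂ => max (‖(a : ℂ) + z‖ ^ 2 - θ) 0) (complexGaussian c.Re) :=
  ((integrable_sq_norm_add a).sub (integrable_const θ)).pos_part

/-- For each `z`, `|a + z|² - θ` is convex in the amplitude `a`, and positive parts and expectations
keep convexity. -/
lemma convexOn_shiftedOvershoot (θ : ℝ) : ConvexOn ℝ Set.univ (c.shiftedOvershoot θ) := by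
  refine ⟨convex_univ, fun a _ b _ p q hp hq hpq => ?_⟩
  simp only [shiftedOvershoot, smul_eq_mul]
  rw [← integral_const_mul, ← integral_const_mul, ← integral_add
    ((c.integrable_shifted θ a).const_mul p) ((c.integrable_shifted θ b).const_mul q)]
  refine integral_mono (c.integrable_shifted θ _)
    (((c.integrable_shifted θ a).const_mul p).add ((c.integrable_shifted θ b).const_mul q))
    fun z => ?_
  simp only [sq_norm_ofReal_add]
  have ha := le_max_left (a ^ 2 + 2 * a * z.re + z.re ^ 2 + z.im ^ 2 - θ) 0
  have ha' := le_max_right (a ^ 2 + 2 * a * z.re + z.re ^ 2 + z.im ^ 2 - θ) 0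
  have hb := le_max_left (b ^ 2 + 2 * b * z.re + z.re ^ 2 + z.im ^ 2 - θ) 0
  have hb' := le_max_right (b ^ 2 + 2 * b * z.re + z.re ^ 2 + z.im ^ 2 - θ) 0
  refine max_le ?_ (by positivity)
  have h1 := mul_le_mul_of_nonneg_left ha hp
  have h2 := mul_le_mul_of_nonneg_left hb hq
  refine le_trans ?_ (add_le_add h1 h2)
  -- This is the convexity defect of the square at the weights `p` and `q`.
  have : 0 ≤ p * q * (a - b) ^ 2 := by positivity
  obtain rfl : q = 1 - p := by linarith
  nlinarith

lemma shiftedOvershoot_neg (θ a : ℝ) : c.shiftedOvershoot θ (-a) = c.shiftedOvershoot θ a := by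
  have h := map_mul_complexGaussian c.Re_pos.le (-1)
  simp only [norm_neg, norm_one, one_pow, one_mul] at h
  rw [shiftedOvershoot, ← h, integral_map (by fun_prop) (by fun_prop), shiftedOvershoot]
  congr 1
  ext z
  rw [show ((-a : ℝ) : ℂ) + -1 * z = -((a : ℂ) + z) by push_cast; ring, norm_neg]

/-- Averaging over `a` and `-a` cancels the cross term `2 a Re z`. Where `|z|² > θ` the average
exceeds `|z|² - θ` by at least `a²`, and that event has probability `exp (-(θ / R_e))`; elsewhere
nonnegativity suffices. -/
lemma shiftedOvershoot_zero_add_le {θ : ℝ} (hθ : 0 ≤ θ) (a : ℝ) :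
    c.shiftedOvershoot θ 0 + a ^ 2 * Real.exp (-(θ / c.Re)) ≤ c.shiftedOvershoot θ a := by
  have hS : MeasurableSet {z : ℂ | θ < ‖z‖ ^ 2} := measurableSet_lt (by fun_prop) (by fun_prop)
  have h1 : c.shiftedOvershoot θ a = 2⁻¹ * (c.shiftedOvershoot θ a + c.shiftedOvershoot θ (-a)) := by
    rw [c.shiftedOvershoot_neg]; ring
  rw [h1, ← complexGaussian_tail c.Re_pos hθ, ← integral_indicator_one hS]
  simp only [shiftedOvershoot]
  have hind : Integrable (Set.indicator {z : ℂ | θ < ‖z‖ ^ 2} (1 : ℂ → ℝ)) (complexGaussian c.Re) :=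
    (integrable_const (1 : ℝ)).indicator hS
  rw [← integral_add (c.integrable_shifted θ a) (c.integrable_shifted θ (-a)),
    ← integral_const_mul, ← integral_const_mul,
    ← integral_add (c.integrable_shifted θ 0) (hind.const_mul _)]
  refine integral_mono ((c.integrable_shifted θ 0).add (hind.const_mul _))
    (((c.integrable_shifted θ a).add (c.integrable_shifted θ (-a))).const_mul _) fun z => ?_
  have hz : ‖z‖ ^ 2 = z.re ^ 2 + z.im ^ 2 := by simpa using sq_norm_ofReal_add 0 z
  simp only [sq_norm_ofReal_add]
  have ha := le_max_left (a ^ 2 + 2 * a * z.re + z.re ^ 2 + z.im ^ 2 - θ) 0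
  have ha' := le_max_right (a ^ 2 + 2 * a * z.re + z.re ^ 2 + z.im ^ 2 - θ) 0
  have hb := le_max_left ((-a) ^ 2 + 2 * (-a) * z.re + z.re ^ 2 + z.im ^ 2 - θ) 0
  have hb' := le_max_right ((-a) ^ 2 + 2 * (-a) * z.re + z.re ^ 2 + z.im ^ 2 - θ) 0
  by_cases h : θ < ‖z‖ ^ 2
  · rw [Set.indicator_of_mem (show z ∈ {z : ℂ | θ < ‖z‖ ^ 2} from h), max_eq_left (by linarith)]
    simp only [Pi.one_apply]
    linarith
  · rw [Set.indicator_of_notMem (show z ∉ {z : ℂ | θ < ‖z‖ ^ 2} from h), max_eq_right (by linarith)]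
    linarith

/-- A convex function that lies strictly above its value at `0` for every positive argument is
strictly increasing on the half-line: `a` is a convex combination of `0` and `b` with weight `a / b
< 1` on `b`. -/
lemma shiftedOvershoot_strictMonoOn {θ : ℝ} (hθ : 0 ≤ θ) :
    StrictMonoOn (c.shiftedOvershoot θ) (Set.Ici 0) := by
  intro a ha b hb hab
  have ha : 0 ≤ a := ha
  have hb0 : 0 < b := by linarith
  have h0 : c.shiftedOvershoot θ 0 < c.shiftedOvershoot θ b := by
    have := c.shiftedOvershoot_zero_add_le hθ b
    have : 0 < b ^ 2 * Real.exp (-(θ / c.Re)) := by positivity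
    linarith
  have hc := (c.convexOn_shiftedOvershoot θ).2 (Set.mem_univ 0) (Set.mem_univ b)
    (show 0 ≤ 1 - a / b by rw [sub_nonneg, div_le_one hb0]; exact hab.le)
    (show 0 ≤ a / b by positivity) (by ring)
  have hab' : a / b < 1 := (div_lt_one hb0).mpr hab
  simp only [smul_eq_mul, mul_zero, zero_add, div_mul_cancel₀ _ hb0.ne'] at hc
  nlinarith

lemma continuous_shiftedOvershoot (θ : ℝ) : Continuous (c.shiftedOvershoot θ) :=
  continuousOn_univ.mp ((c.convexOn_shiftedOvershoot θ).continuousOn isOpen_univ)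

lemma continuous_overshoot (θ : ℝ) : Continuous (c.overshoot θ) := by
  have := c.continuous_shiftedOvershoot θ
  rw [funext (c.overshoot_eq_shifted θ)]
  fun_prop

lemma overshoot_strictMonoOn {θ : ℝ} (hθ : 0 ≤ θ) :
    StrictMonoOn (c.overshoot θ) (Set.Ici 0) := by
  intro x hx y _ hxy
  rw [c.overshoot_eq_shifted, c.overshoot_eq_shifted]
  exact c.shiftedOvershoot_strictMonoOn hθ (Real.sqrt_nonneg _) (Real.sqrt_nonneg _)
    (Real.sqrt_lt_sqrt (mul_nonneg c.cr_pos.le hx) (mul_lt_mul_of_pos_left hxy c.cr_pos))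

lemma le_overshoot (θ : ℝ) {x : ℝ} (hx : 0 ≤ x) : c.cr * x + c.Re - θ ≤ c.overshoot θ x := by
  rw [c.overshoot_eq_add_undershoot θ hx]
  linarith [c.undershoot_nonneg θ x]

lemma one_sub_G (u x : ℝ) : 1 - c.G u x = (c.condRate x).real (Set.Ioi u) := by
  rw [G, ← probReal_compl_eq_one_sub measurableSet_Iic, Set.compl_Iic]

/-- Layer-cake formula for `(R⁽²⁾ - θ)⁺`, with the levels shifted by `θ`. It turns the first
equation of Strategy A into `J_θ(xJ, 0) = 0`. -/
lemma integral_one_sub_G (θ x : ℝ) :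
    ∫ u in Set.Ioi θ, (1 - c.G u x) = c.overshoot θ x := by
  rw [overshoot, (c.integrable_overshoot θ x).integral_eq_integral_meas_lt
    (.of_forall fun _ => le_max_right _ _)]
  simp only [one_sub_G]
  have h := (measurePreserving_add_right volume θ).setIntegral_preimage_emb
    (measurableEmbedding_addRight θ) (fun u => (c.condRate x).real (Set.Ioi u)) (Set.Ioi θ)
  rw [Set.preimage_add_const_Ioi, sub_self] at h
  rw [← h]
  refine setIntegral_congr_fun measurableSet_Ioi fun t ht => ?_
  have ht : 0 < t := ht
  congr 1
  ext y
  simp [ht.not_gt, lt_sub_iff_add_lt]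

lemma G_zero_tail {u : ℝ} (hu : 0 ≤ u) : 1 - c.G u 0 = Real.exp (-(u / c.Re)) := by
  rw [one_sub_G, ← complexGaussian_tail c.Re_pos hu, condRate,
    map_measureReal_apply (by fun_prop) measurableSet_Ioi]
  simp [Set.preimage]

/-- At `x = 0` the rate is exponential with mean `R_e`; this is where the exponential in the
hypothesis on `θ*` comes from. -/
lemma overshoot_zero {θ : ℝ} (hθ : 0 ≤ θ) :
    c.overshoot θ 0 = c.Re * Real.exp (-(θ / c.Re)) := by
  rw [← integral_one_sub_G, setIntegral_congr_fun measurableSet_Ioi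
    (fun u hu => c.G_zero_tail (hθ.trans (le_of_lt hu)))]
  have hd : ∀ r : ℝ, HasDerivAt (fun r => -(c.Re * Real.exp (-(r / c.Re))))
      (Real.exp (-(r / c.Re))) r := by
    intro r
    have := ((((hasDerivAt_id r).div_const c.Re).neg.exp).const_mul c.Re).neg
    convert! this using 1
    have := c.Re_pos.ne'
    simp
    field_simp
  have ht : Filter.Tendsto (fun r : ℝ => -(c.Re * Real.exp (-(r / c.Re)))) Filter.atTop
      (nhds 0) := by
    rw [← neg_zero, ← mul_zero c.Re]
    exact ((Real.tendsto_exp_neg_atTop_nhds_zero.comp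
      (Filter.tendsto_id.atTop_div_const c.Re_pos)).const_mul _).neg
  rw [integral_Ioi_of_hasDerivAt_of_nonneg' (fun r _ => hd r) (fun r _ => by positivity) ht]
  ring

/-- Layer-cake formula for `(θ - R⁽²⁾)⁺`, whose levels stop at `θ` because the rate is almost surely
nonnegative. -/
lemma integral_G {θ : ℝ} (hθ : 0 ≤ θ) (x : ℝ) :
    ∫ u in (0 : ℝ)..θ, c.G u x = c.undershoot θ x := by
  have hb : (fun y => max (θ - y) 0) ≤ᵐ[c.condRate x] fun _ => θ := by
    filter_upwards [c.ae_nonneg_condRate x] with y hy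
    simp [hθ, hy]
  rw [undershoot, (c.integrable_undershoot θ x).integral_eq_integral_Ioc_meas_le
    (.of_forall fun _ => le_max_right _ _) hb]
  have h := intervalIntegral.integral_comp_sub_left (fun u => c.G u x) θ (a := 0) (b := θ)
  rw [sub_self, sub_zero] at h
  rw [← h, intervalIntegral.integral_of_le hθ]
  refine setIntegral_congr_fun measurableSet_Ioc fun t ht => ?_
  have ht : 0 < t := ht.1
  simp only [G]
  congr 1
  ext y
  simp [ht.not_ge, le_sub_comm]

end Params

/-! ### Joint law of the first estimate and its increment -/

namespace Params
variable (c : Params)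

/-- The variance of the first-level channel estimate. -/
noncomputable def firstVar (c : Params) : ℝ := c.ρ * c.M / (c.ρ * c.M + 1)

/-- The first-level channel estimate as a function of the gain and the noise. -/
noncomputable def firstEstimate (p : ℂ × (Fin (2 * c.M) → ℂ)) : ℂ :=
  ((Real.sqrt c.ρ / (c.ρ * c.M + 1) : ℝ) : ℂ) *
    ∑ m ∈ Finset.univ.filter (fun m : Fin (2 * c.M) => (m : ℕ) < c.M),
      (((Real.sqrt c.ρ : ℝ) : ℂ) * p.1 + p.2 m)

/-- The second-level channel estimate as a function of the gain and the noise. -/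
noncomputable def secondEstimate (p : ℂ × (Fin (2 * c.M) → ℂ)) : ℂ :=
  ((Real.sqrt c.ρ / (2 * c.ρ * c.M + 1) : ℝ) : ℂ) *
    ∑ m : Fin (2 * c.M), (((Real.sqrt c.ρ : ℝ) : ℂ) * p.1 + p.2 m)

lemma card_filter_lt :
    (Finset.univ.filter (fun m : Fin (2 * c.M) => (m : ℕ) < c.M)).card = c.M := by
  rw [Fin.card_filter_val_lt]
  omega

lemma card_filter_not_lt :
    (Finset.univ.filter (fun m : Fin (2 * c.M) => ¬ (m : ℕ) < c.M)).card = c.M := by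
  have h := Finset.card_filter_add_card_filter_not (s := (Finset.univ : Finset (Fin (2 * c.M))))
    (fun m : Fin (2 * c.M) => (m : ℕ) < c.M)
  rw [card_filter_lt, Finset.card_univ, Fintype.card_fin] at h
  omega

lemma measurable_firstEstimate : Measurable c.firstEstimate := by
  unfold firstEstimate; fun_prop

lemma measurable_secondEstimate : Measurable c.secondEstimate := by
  unfold secondEstimate; fun_prop

lemma firstEstimate_eq (p : ℂ × (Fin (2 * c.M) → ℂ)) :
    c.firstEstimate p = ((Real.sqrt c.ρ / (c.ρ * c.M + 1) : ℝ) : ℂ) *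
      ((c.M : ℂ) * (((Real.sqrt c.ρ : ℝ) : ℂ) * p.1) +
        ∑ m ∈ Finset.univ.filter (fun m : Fin (2 * c.M) => (m : ℕ) < c.M), p.2 m) := by
  simp [firstEstimate, Finset.sum_add_distrib, card_filter_lt]

lemma secondEstimate_eq (p : ℂ × (Fin (2 * c.M) → ℂ)) :
    c.secondEstimate p = ((Real.sqrt c.ρ / (2 * c.ρ * c.M + 1) : ℝ) : ℂ) *
      (((2 * c.M : ℝ) : ℂ) * (((Real.sqrt c.ρ : ℝ) : ℂ) * p.1) + ∑ m, p.2 m) := by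
  simp [secondEstimate, Finset.sum_add_distrib]

/-- The coefficient with which a pilot noise enters the linear combination of the two estimates
tested by the frequencies `t` and `u`. -/
noncomputable def noiseFreq (t u : ℂ) (m : Fin (2 * c.M)) : ℂ :=
  if (m : ℕ) < c.M then ((Real.sqrt c.ρ / (c.ρ * c.M + 1) : ℝ) : ℂ) * (t - u) +
    ((Real.sqrt c.ρ / (2 * c.ρ * c.M + 1) : ℝ) : ℂ) * u
  else ((Real.sqrt c.ρ / (2 * c.ρ * c.M + 1) : ℝ) : ℂ) * u

/-- The coefficient with which the channel gain enters this combination. -/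
noncomputable def gainFreq (t u : ℂ) : ℂ :=
  (((Real.sqrt c.ρ * c.M : ℝ) : ℂ)) * (((Real.sqrt c.ρ / (c.ρ * c.M + 1) : ℝ) : ℂ) * (t - u) +
    ((Real.sqrt c.ρ / (2 * c.ρ * c.M + 1) * 2 : ℝ) : ℂ) * u)

lemma inner_estimates (p : ℂ × (Fin (2 * c.M) → ℂ)) (t u : ℂ) :
    inner ℝ (c.firstEstimate p) t + inner ℝ (c.secondEstimate p - c.firstEstimate p) u =
      inner ℝ p.1 (c.gainFreq t u) + ∑ m, inner ℝ (p.2 m) (c.noiseFreq t u m) := by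
  have h1 : ∑ m, inner ℝ (p.2 m) (c.noiseFreq t u m) =
      inner ℝ (∑ m ∈ Finset.univ.filter (fun m : Fin (2 * c.M) => (m : ℕ) < c.M), p.2 m)
        (((Real.sqrt c.ρ / (c.ρ * c.M + 1) : ℝ) : ℂ) * (t - u)) +
      inner ℝ (∑ m, p.2 m) (((Real.sqrt c.ρ / (2 * c.ρ * c.M + 1) : ℝ) : ℂ) * u) := by
    rw [sum_inner, sum_inner, Finset.sum_filter, ← Finset.sum_add_distrib]
    refine Finset.sum_congr rfl fun m _ => ?_
    unfold noiseFreq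
    split_ifs
    · rw [inner_add_right]
    · rw [zero_add]
  rw [h1, firstEstimate_eq, secondEstimate_eq, gainFreq]
  generalize ∑ m ∈ Finset.univ.filter (fun m : Fin (2 * c.M) => (m : ℕ) < c.M), p.2 m = S
  generalize ∑ m, p.2 m = S'
  simp only [Complex.inner, map_add, map_sub, map_mul, Complex.conj_ofReal, Complex.add_re,
    Complex.sub_re, Complex.mul_re, Complex.ofReal_re, Complex.ofReal_im, Complex.sub_im,
    Complex.mul_im, Complex.add_im, Complex.conj_re, Complex.conj_im, Complex.natCast_re,
    Complex.natCast_im, map_natCast]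
  ring

/-- The absence of a cross term in `t` and `u` is the orthogonality of an MMSE estimate to the later
correction; it holds for these particular normalizations of the two estimates. -/
lemma sum_sq_norm_freq (t u : ℂ) :
    ‖c.gainFreq t u‖ ^ 2 + ∑ m, ‖c.noiseFreq t u m‖ ^ 2 =
      c.firstVar * ‖t‖ ^ 2 + c.σe2 * ‖u‖ ^ 2 := by
  have h2 : ∑ m, ‖c.noiseFreq t u m‖ ^ 2 = c.M * ‖((Real.sqrt c.ρ / (c.ρ * c.M + 1) : ℝ) : ℂ) *
      (t - u) + ((Real.sqrt c.ρ / (2 * c.ρ * c.M + 1) : ℝ) : ℂ) * u‖ ^ 2 +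
      c.M * ‖((Real.sqrt c.ρ / (2 * c.ρ * c.M + 1) : ℝ) : ℂ) * u‖ ^ 2 := by
    rw [← Finset.sum_filter_add_sum_filter_not _ (fun m : Fin (2 * c.M) => (m : ℕ) < c.M)]
    congr 1
    · rw [Finset.sum_congr rfl (fun m hm => by rw [noiseFreq, if_pos (Finset.mem_filter.mp hm).2]),
        Finset.sum_const, card_filter_lt, nsmul_eq_mul]
    · rw [Finset.sum_congr rfl (fun m hm => by rw [noiseFreq, if_neg (Finset.mem_filter.mp hm).2]),
        Finset.sum_const, card_filter_not_lt, nsmul_eq_mul]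
  have hs : Real.sqrt c.ρ ^ 2 = c.ρ := Real.sq_sqrt c.ρ_pos.le
  have hM : (0 : ℝ) < c.M := by exact_mod_cast c.M_pos
  have hρ := c.ρ_pos
  have e1 : c.ρ * c.M + 1 ≠ 0 := by positivity
  have e2 : 2 * c.ρ * c.M + 1 ≠ 0 := by positivity
  rw [h2, gainFreq, firstVar, σe2]
  simp only [Complex.sq_norm, Complex.normSq_apply, Complex.add_re,
    Complex.sub_re, Complex.mul_re, Complex.ofReal_re, Complex.ofReal_im, Complex.sub_im,
    Complex.mul_im, Complex.add_im]
  rw [show (c.M : ℝ) * c.ρ + 1 = c.ρ * c.M + 1 by ring,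
    show 2 * (c.M : ℝ) * c.ρ + 1 = 2 * c.ρ * c.M + 1 by ring]
  generalize Real.sqrt c.ρ = q at *
  rw [← hs] at e1 e2 ⊢
  field_simp
  ring

/-- Both estimates are linear in independent Gaussians, so the joint characteristic function is the
exponential of a quadratic form. That form has no cross term, so the function factors, which gives
independence. -/
lemma map_estimates :
    ((complexGaussian 1).prod (Measure.pi (fun _ : Fin (2 * c.M) => complexGaussian 1))).map
      (fun p => (c.firstEstimate p, c.secondEstimate p - c.firstEstimate p)) =
      (complexGaussian c.firstVar).prod (complexGaussian c.σe2) := by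
  have hm : Measurable (fun p : ℂ × (Fin (2 * c.M) → ℂ) =>
      (c.firstEstimate p, c.secondEstimate p - c.firstEstimate p)) :=
    c.measurable_firstEstimate.prodMk (c.measurable_secondEstimate.sub c.measurable_firstEstimate)
  have := Measure.isProbabilityMeasure_map (μ := (complexGaussian 1).prod
    (Measure.pi (fun _ : Fin (2 * c.M) => complexGaussian 1))) hm.aemeasurable
  have hv : 0 ≤ c.firstVar := by
    have := c.ρ_pos
    unfold firstVar; positivity
  rw [← charFun_eq_prod_iff]
  intro t
  rw [charFun_complexGaussian hv, charFun_complexGaussian c.σe2_pos.le, charFun_apply,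
    integral_map (by fun_prop) (Continuous.aestronglyMeasurable (by fun_prop)),
    integral_map hm.aemeasurable (Continuous.aestronglyMeasurable (by fun_prop))]
  have hI : ∀ p : ℂ × (Fin (2 * c.M) → ℂ),
      Complex.exp ((inner ℝ (WithLp.toLp 2 (c.firstEstimate p, c.secondEstimate p -
        c.firstEstimate p)) t : ℝ) * Complex.I) =
      Complex.exp ((inner ℝ p.1 (c.gainFreq t.ofLp.1 t.ofLp.2) : ℝ) * Complex.I) *
        ∏ m, Complex.exp ((inner ℝ (p.2 m) (c.noiseFreq t.ofLp.1 t.ofLp.2 m) : ℝ) * Complex.I) := by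
    intro p
    rw [WithLp.prod_inner_apply]
    have := c.inner_estimates p t.ofLp.1 t.ofLp.2
    dsimp only at this ⊢
    rw [← Complex.exp_sum, ← Complex.exp_add]
    congr 1
    rw [this]
    push_cast
    rw [add_mul, Finset.sum_mul]
  simp_rw [hI]
  rw [integral_prod_mul (fun h : ℂ => Complex.exp ((inner ℝ h (c.gainFreq t.ofLp.1 t.ofLp.2) : ℝ) *
      Complex.I)) (fun ξ : Fin (2 * c.M) → ℂ => ∏ m, Complex.exp ((inner ℝ (ξ m)
        (c.noiseFreq t.ofLp.1 t.ofLp.2 m) : ℝ) * Complex.I)),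
    integral_fintype_prod_eq_prod (fun (m : Fin (2 * c.M)) (x : ℂ) =>
      Complex.exp ((inner ℝ x (c.noiseFreq t.ofLp.1 t.ofLp.2 m) : ℝ) * Complex.I))]
  simp only [← charFun_apply, charFun_complexGaussian zero_le_one]
  rw [← Complex.exp_sum, ← Complex.exp_add, ← Complex.exp_add]
  congr 1
  have := c.sum_sq_norm_freq t.ofLp.1 t.ofLp.2
  rw [Finset.sum_neg_distrib, ← Complex.ofReal_sum, ← Complex.ofReal_neg, ← Complex.ofReal_neg,
    ← Complex.ofReal_neg, ← Complex.ofReal_neg, ← Complex.ofReal_add, ← Complex.ofReal_add]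
  congr 1
  simp only [one_mul]
  rw [← Finset.sum_div]
  linarith

end Params

/-! ### Signals of a round and independence of the past -/

namespace Channel
variable {c : Params} {Ω : Type*} [MeasurableSpace Ω] {P : Measure Ω} (C : Channel c P)

lemma hhat1_eq (n : ℕ) (ω : Ω) : C.hhat1 n ω = c.firstEstimate (C.h n ω, C.ξ n ω) := rfl
lemma hhat2_eq (n : ℕ) (ω : Ω) : C.hhat2 n ω = c.secondEstimate (C.h n ω, C.ξ n ω) := rfl

/-- The estimation increment gained by second-level probing. -/
noncomputable def increment (n : ℕ) (ω : Ω) : ℂ := C.hhat2 n ω - C.hhat1 n ω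

/-- All signals of a round. -/
def round (n : ℕ) (ω : Ω) : ℕ × ℂ × (Fin (2 * c.M) → ℂ) := (C.K n ω, C.h n ω, C.ξ n ω)

lemma measurable_round (n : ℕ) : Measurable (C.round n) :=
  (C.measurable_K n).prodMk ((C.measurable_h n).prodMk (C.measurable_ξ n))

/-- The contention time, first-level estimate and increment, as a function of the signals. -/
noncomputable def summary (c : Params) (r : ℕ × ℂ × (Fin (2 * c.M) → ℂ)) : ℕ × ℂ × ℂ :=
  (r.1, c.firstEstimate r.2, c.secondEstimate r.2 - c.firstEstimate r.2)

lemma measurable_summary : Measurable (summary c) := by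
  have h1 := c.measurable_firstEstimate
  have h2 := c.measurable_secondEstimate
  unfold summary
  fun_prop

instance : IsProbabilityMeasure c.contentionLaw :=
  Measure.isProbabilityMeasure_map (by fun_prop)

lemma map_summary (n : ℕ) :
    P.map (fun ω => (C.K n ω, C.hhat1 n ω, C.increment n ω)) =
      c.contentionLaw.prod ((complexGaussian c.firstVar).prod (complexGaussian c.σe2)) := by
  have hm : Measurable (fun p : ℂ × (Fin (2 * c.M) → ℂ) =>
      (c.firstEstimate p, c.secondEstimate p - c.firstEstimate p)) :=
    c.measurable_firstEstimate.prodMk (c.measurable_secondEstimate.sub c.measurable_firstEstimate)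
  have h := Measure.map_prod_map c.contentionLaw ((complexGaussian 1).prod
    (Measure.pi (fun _ : Fin (2 * c.M) => complexGaussian 1))) measurable_id hm
  rw [Measure.map_id, c.map_estimates] at h
  have hr : Measurable (fun ω => (C.K n ω, C.h n ω, C.ξ n ω)) := C.measurable_round n
  rw [h, ← C.law_round n, Measure.map_map (measurable_id.prodMap hm) hr]
  rfl

end Channel

lemma Params.integral_contentionLaw (c : Params) :
    Integrable (fun k : ℕ => (k : ℝ)) c.contentionLaw ∧
      ∫ k : ℕ, (k : ℝ) ∂c.contentionLaw = 1 / c.ps := by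
  have hp : (⟨c.ps, c.ps_pos.le, c.ps_le⟩ : unitInterval) ≠ 0 := fun h =>
    c.ps_pos.ne' (congrArg Subtype.val h)
  have hq : ‖1 - c.ps‖ < 1 := by
    rw [Real.norm_eq_abs, abs_lt]
    constructor <;> linarith [c.ps_pos, c.ps_le]
  have h1 := hasSum_coe_mul_geometric_of_norm_lt_one hq
  have h2 := hasSum_geometric_of_norm_lt_one hq
  have h3 : HasSum (fun n : ℕ => (1 - c.ps) ^ n * c.ps * ((n : ℝ) + 1)) (1 / c.ps) := by
    have := (h1.add h2).mul_left c.ps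
    convert! this using 1
    · ext n; ring
    · have := c.ps_pos.ne'
      rw [sub_sub_cancel]
      field_simp
      ring
  constructor
  · rw [Params.contentionLaw, integrable_map_measure (by fun_prop) (by fun_prop)]
    rw [integrable_geometricMeasure_iff hp]
    refine h3.summable.congr fun n => ?_
    simp only [Function.comp_apply, Real.norm_eq_abs]
    rw [abs_of_nonneg (by positivity)]
    push_cast
    rfl
  · rw [Params.contentionLaw, integral_map (by fun_prop) (by fun_prop),
      integral_geometricMeasure hp, ← h3.tsum_eq]
    simp

/-- The joint law is a triple product that only needs reassociating. This serves to isolate the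
increment from the contention time, the first estimate and all earlier rounds together. -/
lemma IndepFun.prodMk_left_of_prodMk_right {Ω A V E : Type*} [MeasurableSpace Ω] {P : Measure Ω}
    [IsProbabilityMeasure P] [MeasurableSpace A] [MeasurableSpace V] [MeasurableSpace E]
    {X : Ω → A} {Y : Ω → V} {Z : Ω → E} (hX : Measurable X) (hY : Measurable Y)
    (hZ : Measurable Z) (h : IndepFun X (fun ω => (Y ω, Z ω)) P) (h' : IndepFun Y Z P) :
    IndepFun (fun ω => (X ω, Y ω)) Z P := by
  have hYZ := (indepFun_iff_map_prod_eq_prod_map_map hY.aemeasurable hZ.aemeasurable).mp h'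
  have hXYZ := (indepFun_iff_map_prod_eq_prod_map_map hX.aemeasurable
    (hY.prodMk hZ).aemeasurable).mp h
  have hXY : IndepFun X Y P := h.comp measurable_id measurable_fst
  rw [indepFun_iff_map_prod_eq_prod_map_map (hX.prodMk hY).aemeasurable hZ.aemeasurable,
    (indepFun_iff_map_prod_eq_prod_map_map hX.aemeasurable hY.aemeasurable).mp hXY]
  have := Measure.isProbabilityMeasure_map (μ := P) hX.aemeasurable
  have := Measure.isProbabilityMeasure_map (μ := P) hY.aemeasurable
  have := Measure.isProbabilityMeasure_map (μ := P) hZ.aemeasurable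
  apply MeasurableEquiv.prodAssoc.map_measurableEquiv_injective
  rw [Measure.prodAssoc_prod, ← hYZ, ← hXYZ, Measure.map_map (MeasurableEquiv.measurable _)
    ((hX.prodMk hY).prodMk hZ)]
  rfl

namespace Channel
variable {c : Params} {Ω : Type*} [MeasurableSpace Ω] {P : Measure Ω} (C : Channel c P)

/-- The signals of all rounds before the `n`-th. -/
def past (n : ℕ) (ω : Ω) (j : Finset.range n) : ℕ × ℂ × (Fin (2 * c.M) → ℂ) := C.round j ω

lemma measurable_past (n : ℕ) : Measurable (C.past n) :=
  measurable_pi_lambda _ fun j => C.measurable_round j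

lemma measurable_hhat1 (n : ℕ) : Measurable (C.hhat1 n) := by
  rw [funext (C.hhat1_eq n)]
  exact c.measurable_firstEstimate.comp ((C.measurable_h n).prodMk (C.measurable_ξ n))

lemma measurable_hhat2 (n : ℕ) : Measurable (C.hhat2 n) := by
  rw [funext (C.hhat2_eq n)]
  exact c.measurable_secondEstimate.comp ((C.measurable_h n).prodMk (C.measurable_ξ n))

lemma measurable_increment (n : ℕ) : Measurable (C.increment n) :=
  (C.measurable_hhat2 n).sub (C.measurable_hhat1 n)

/-- The contention time and the first-level estimate of a round. -/
noncomputable def front (n : ℕ) (ω : Ω) : ℕ × ℂ := (C.K n ω, C.hhat1 n ω)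

lemma measurable_front (n : ℕ) : Measurable (C.front n) :=
  (C.measurable_K n).prodMk (C.measurable_hhat1 n)

lemma measurable_R1 (n : ℕ) : Measurable (C.R1 n) := by
  have := C.measurable_hhat1 n
  unfold R1; fun_prop

lemma measurable_R2 (n : ℕ) : Measurable (C.R2 n) := by
  have := C.measurable_hhat2 n
  unfold R2; fun_prop

lemma R1_nonneg (n : ℕ) (ω : Ω) : 0 ≤ C.R1 n ω := by
  have := c.ρ_pos; have := c.W_pos; have := c.σ₁_pos
  unfold R1; positivity

lemma R2_nonneg (n : ℕ) (ω : Ω) : 0 ≤ C.R2 n ω := by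
  have := c.ρ_pos; have := c.W_pos; have := c.σ₂_pos
  unfold R2; positivity

lemma map_K (n : ℕ) : P.map (C.K n) = c.contentionLaw := by
  have h := congrArg (Measure.map Prod.fst) (C.map_summary n)
  rw [Measure.map_map (by fun_prop) ((C.measurable_K n).prodMk ((C.measurable_hhat1 n).prodMk
    (C.measurable_increment n)))] at h
  exact h.trans Measure.fst_prod

lemma map_hhat1_increment (n : ℕ) : P.map (fun ω => (C.hhat1 n ω, C.increment n ω)) =
    (complexGaussian c.firstVar).prod (complexGaussian c.σe2) := by
  have h := congrArg (Measure.map Prod.snd) (C.map_summary n)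
  rw [Measure.map_map (by fun_prop) ((C.measurable_K n).prodMk ((C.measurable_hhat1 n).prodMk
    (C.measurable_increment n)))] at h
  exact h.trans Measure.snd_prod

lemma indepFun_past_round (n : ℕ) : IndepFun (C.past n) (C.round n) P := by
  have h := C.indep_rounds.indepFun_finset (Finset.range n) {n} (by simp) C.measurable_round
  exact h.comp measurable_id
    (measurable_pi_apply (⟨n, Finset.mem_singleton_self n⟩ : ({n} : Finset ℕ)))

lemma map_round (n : ℕ) : P.map (C.round n) = P.map (C.round 0) :=
  (C.law_round n).trans (C.law_round 0).symm

lemma ae_nonneg_firstRateLaw : ∀ᵐ x ∂C.firstRateLaw, 0 ≤ x :=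
  (ae_map_iff (C.measurable_R1 0).aemeasurable measurableSet_Ici).mpr
    (.of_forall (C.R1_nonneg 0))

lemma map_hhat1 (n : ℕ) : P.map (C.hhat1 n) = complexGaussian c.firstVar := by
  have h := congrArg (Measure.map Prod.fst) (C.map_hhat1_increment n)
  rw [Measure.map_map (by fun_prop) ((C.measurable_hhat1 n).prodMk
    (C.measurable_increment n))] at h
  exact h.trans Measure.fst_prod

lemma map_increment (n : ℕ) : P.map (C.increment n) = complexGaussian c.σe2 := by
  have h := congrArg (Measure.map Prod.snd) (C.map_hhat1_increment n)
  rw [Measure.map_map (by fun_prop) ((C.measurable_hhat1 n).prodMk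
    (C.measurable_increment n))] at h
  exact h.trans Measure.snd_prod

lemma integrable_K (n : ℕ) : Integrable (fun ω => (C.K n ω : ℝ)) P := by
  have h := c.integral_contentionLaw.1
  rw [← C.map_K n] at h
  exact h.comp_measurable (C.measurable_K n)

lemma integral_K (n : ℕ) : ∫ ω, (C.K n ω : ℝ) ∂P = 1 / c.ps := by
  rw [← c.integral_contentionLaw.2, ← C.map_K n,
    integral_map (C.measurable_K n).aemeasurable (by fun_prop)]

/-- The first-level information is independent of the past. -/
lemma setIntegral_round_eq {n : ℕ} {g : ℕ × ℂ × (Fin (2 * c.M) → ℂ) → ℝ} (hg : Measurable g)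
    {A : Set Ω} (hA : MeasurableSet[MeasurableSpace.comap (C.past n) inferInstance] A) :
    ∫ ω in A, g (C.round n ω) ∂P = P.real A * ∫ ω, g (C.round n ω) ∂P := by
  exact Indep.setIntegral_eq_mul (C.measurable_past n).comap_le (C.indepFun_past_round n)
    (C.measurable_round n).aemeasurable hA hg.aestronglyMeasurable

lemma integrable_sq_norm_hhat1 (n : ℕ) : Integrable (fun ω => ‖C.hhat1 n ω‖ ^ 2) P := by
  have h := integrable_sq_norm_add (s := c.firstVar) 0
  rw [← C.map_hhat1 n] at h
  simpa [Function.comp_def] using h.comp_measurable (C.measurable_hhat1 n)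

lemma integrable_sq_norm_increment (n : ℕ) : Integrable (fun ω => ‖C.increment n ω‖ ^ 2) P := by
  have h := integrable_sq_norm_add (s := c.σe2) 0
  rw [← C.map_increment n] at h
  simpa [Function.comp_def] using h.comp_measurable (C.measurable_increment n)

lemma map_R1 (n : ℕ) : P.map (C.R1 n) = C.firstRateLaw := by
  have hm : Measurable (fun z : ℂ => c.ρ * c.W * c.σ₁ * ‖z‖ ^ 2) := by fun_prop
  have : ∀ n, P.map (C.R1 n) =
      (complexGaussian c.firstVar).map (fun z : ℂ => c.ρ * c.W * c.σ₁ * ‖z‖ ^ 2) := fun n => by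
    rw [← C.map_hhat1 n, Measure.map_map hm (C.measurable_hhat1 n)]
    rfl
  rw [firstRateLaw, this, this]

lemma integral_R1_pos : 0 < ∫ ω, C.R1 0 ω ∂P := by
  have h0 := integral_sq_norm_add (s := c.firstVar) (by
    have := c.ρ_pos
    unfold Params.firstVar; positivity) 0
  rw [← C.map_hhat1 0, integral_map (C.measurable_hhat1 0).aemeasurable (by fun_prop)] at h0
  simp only [Complex.ofReal_zero, zero_add] at h0
  simp only [R1]
  rw [integral_const_mul, h0]
  have := c.ρ_pos; have := c.W_pos; have := c.σ₁_pos
  have : (0 : ℝ) < c.M := by exact_mod_cast c.M_pos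
  unfold Params.firstVar
  positivity

lemma integrable_R1 (n : ℕ) : Integrable (C.R1 n) P :=
  (C.integrable_sq_norm_hhat1 n).const_mul _

lemma integrable_R2 (n : ℕ) : Integrable (C.R2 n) P := by
  refine Integrable.const_mul ?_ _
  have hd := ((C.integrable_sq_norm_hhat1 n).const_mul 2).add
    ((C.integrable_sq_norm_increment n).const_mul 2)
  have := C.measurable_hhat2 n
  refine hd.mono' (by fun_prop) (.of_forall fun ω => ?_)
  rw [Real.norm_of_nonneg (by positivity)]
  have h1 : ‖C.hhat2 n ω‖ ≤ ‖C.hhat1 n ω‖ + ‖C.increment n ω‖ := by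
    have := norm_add_le (C.hhat1 n ω) (C.increment n ω)
    simpa [increment] using this
  have h2 := norm_nonneg (C.hhat2 n ω)
  simp only [Pi.add_apply]
  nlinarith [sq_nonneg (‖C.hhat1 n ω‖ - ‖C.increment n ω‖)]

lemma integral_firstRateLaw {f : ℝ → ℝ} (hf : Measurable f) (n : ℕ) :
    ∫ x, f x ∂C.firstRateLaw = ∫ ω, f (C.R1 n ω) ∂P := by
  rw [← C.map_R1 n, integral_map (C.measurable_R1 n).aemeasurable hf.aestronglyMeasurable]

variable [IsProbabilityMeasure P]

lemma indepFun_front_increment (n : ℕ) : IndepFun (C.front n) (C.increment n) P := by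
  have hKh : IndepFun (C.K n) (fun ω => (C.hhat1 n ω, C.increment n ω)) P := by
    rw [indepFun_iff_map_prod_eq_prod_map_map (C.measurable_K n).aemeasurable
      ((C.measurable_hhat1 n).prodMk (C.measurable_increment n)).aemeasurable, C.map_K,
      C.map_hhat1_increment]
    exact C.map_summary n
  have hhe : IndepFun (C.hhat1 n) (C.increment n) P := by
    rw [indepFun_iff_map_prod_eq_prod_map_map (C.measurable_hhat1 n).aemeasurable
      (C.measurable_increment n).aemeasurable, C.map_hhat1, C.map_increment]
    exact C.map_hhat1_increment n
  exact IndepFun.prodMk_left_of_prodMk_right (C.measurable_K n) (C.measurable_hhat1 n)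
    (C.measurable_increment n) hKh hhe

lemma indepFun_past_front_increment (n : ℕ) :
    IndepFun (fun ω => (C.past n ω, C.front n ω)) (C.increment n) P := by
  refine IndepFun.prodMk_left_of_prodMk_right (C.measurable_past n) (C.measurable_front n)
    (C.measurable_increment n) ?_ (C.indepFun_front_increment n)
  refine (C.indepFun_past_round n).comp (φ := id)
    (ψ := fun r => (((summary c r).1, (summary c r).2.1), (summary c r).2.2)) measurable_id ?_
  have h := measurable_summary (c := c)
  exact (h.fst.prodMk h.snd.fst).prodMk h.snd.snd

instance isProbabilityMeasure_firstRateLaw : IsProbabilityMeasure C.firstRateLaw :=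
  Measure.isProbabilityMeasure_map (C.measurable_R1 0).aemeasurable

end Channel

/-- The second-level rate given the first-level estimate `a`. -/
lemma Params.integral_rate_given_estimate (c : Params) {f : ℝ → ℝ} (hf : Measurable f) (a : ℂ) :
    ∫ e, f (c.ρ * c.W * c.σ₂ * ‖a + e‖ ^ 2) ∂complexGaussian c.σe2 =
      ∫ y, f y ∂c.condRate (c.ρ * c.W * c.σ₁ * ‖a‖ ^ 2) := by
  have hk : 0 < c.ρ * c.W * c.σ₂ := mul_pos (mul_pos c.ρ_pos c.W_pos) c.σ₂_pos
  -- A rotation takes `a` to `‖a‖`. By circular symmetry it does not affect the law of the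
  -- increment, so only `‖a‖` matters.
  obtain ⟨u, hu, hua⟩ : ∃ u : ℂ, ‖u‖ = 1 ∧ u * a = ‖a‖ := by
    by_cases ha : a = 0
    · exact ⟨1, by simp, by simp [ha]⟩
    · have hn : (‖a‖ : ℂ) ≠ 0 := by simpa using ha
      refine ⟨star a / ‖a‖, by simp [ha], ?_⟩
      rw [div_mul_eq_mul_div, div_eq_iff hn]
      simpa [sq] using Complex.conj_mul' a
  set b : ℂ := ((Real.sqrt (c.ρ * c.W * c.σ₂) : ℝ) : ℂ) * u with hb
  have hbn : ‖b‖ ^ 2 = c.ρ * c.W * c.σ₂ := by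
    rw [hb, norm_mul, hu, mul_one, Complex.norm_real, Real.norm_of_nonneg (Real.sqrt_nonneg _),
      Real.sq_sqrt hk.le]
  have hcr : c.cr * (c.ρ * c.W * c.σ₁ * ‖a‖ ^ 2) = (c.ρ * c.W * c.σ₂) * ‖a‖ ^ 2 := by
    have := c.σ₁_pos.ne'
    unfold Params.cr
    field_simp
  have hba : ((Real.sqrt (c.cr * (c.ρ * c.W * c.σ₁ * ‖a‖ ^ 2)) : ℝ) : ℂ) = b * a := by
    rw [hcr, Real.sqrt_mul hk.le, Real.sqrt_sq (norm_nonneg a), hb, Complex.ofReal_mul, ← hua]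
    ring
  have hmap := map_mul_complexGaussian c.σe2_pos.le b
  rw [hbn, show c.ρ * c.W * c.σ₂ * c.σe2 = c.Re by unfold Params.Re; ring] at hmap
  rw [c.integral_condRate hf, ← hmap,
    integral_map (by fun_prop) (Measurable.aestronglyMeasurable (by fun_prop))]
  congr 1
  ext e
  rw [hba, ← mul_add, norm_mul, mul_pow, hbn]

namespace Channel
variable {c : Params} {Ω : Type*} [MeasurableSpace Ω] {P : Measure Ω} (C : Channel c P)
variable [IsProbabilityMeasure P]

/-- The increment is independent of the past and of the front of round `n`, so Fubini permits
integrating it out first. With `B` arbitrary in that σ-algebra, this is the conditional expectation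
of `f (R⁽²⁾)`. -/
lemma setIntegral_R2_eq {n : ℕ} {f : ℝ → ℝ} (hf : Measurable f)
    (hint : Integrable (fun ω => f (C.R2 n ω)) P) {B : Set Ω}
    (hB : MeasurableSet[MeasurableSpace.comap (fun ω => (C.past n ω, C.front n ω)) inferInstance] B) :
    ∫ ω in B, f (C.R2 n ω) ∂P = ∫ ω in B, (∫ y, f y ∂c.condRate (C.R1 n ω)) ∂P := by
  obtain ⟨S, hS, rfl⟩ := hB
  have hU : Measurable (fun ω => (C.past n ω, C.front n ω)) :=
    (C.measurable_past n).prodMk (C.measurable_front n)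
  have hB : MeasurableSet ((fun ω => (C.past n ω, C.front n ω)) ⁻¹' S) := hU hS
  have he := C.measurable_increment n
  have hprod := (indepFun_iff_map_prod_eq_prod_map_map hU.aemeasurable he.aemeasurable).mp
    (C.indepFun_past_front_increment n)
  rw [C.map_increment] at hprod
  set F : (((Finset.range n) → ℕ × ℂ × (Fin (2 * c.M) → ℂ)) × ℕ × ℂ) × ℂ → ℝ := fun q =>
    S.indicator (fun _ => (1 : ℝ)) q.1 * f (c.ρ * c.W * c.σ₂ * ‖q.1.2.2 + q.2‖ ^ 2) with hF
  have hFm : Measurable F := by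
    have h1 : Measurable (S.indicator (fun _ => (1 : ℝ))) := measurable_const.indicator hS
    rw [hF]; fun_prop
  have hFω : ∀ ω, F ((C.past n ω, C.front n ω), C.increment n ω) =
      ((fun ω => (C.past n ω, C.front n ω)) ⁻¹' S).indicator (fun ω => f (C.R2 n ω)) ω := by
    intro ω
    have : C.hhat1 n ω + C.increment n ω = C.hhat2 n ω := by simp [increment]
    by_cases h : (C.past n ω, C.front n ω) ∈ S
    · rw [Set.indicator_of_mem (show ω ∈ (fun ω => (C.past n ω, C.front n ω)) ⁻¹' S from h)]
      simp only [hF]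
      rw [Set.indicator_of_mem h, one_mul]
      simp only [front, this, R2]
    · rw [Set.indicator_of_notMem (show ω ∉ (fun ω => (C.past n ω, C.front n ω)) ⁻¹' S from h)]
      simp only [hF, Set.indicator_of_notMem h, zero_mul]
  have hFint : Integrable F ((P.map (fun ω => (C.past n ω, C.front n ω))).prod
      (complexGaussian c.σe2)) := by
    rw [← hprod, integrable_map_measure hFm.aestronglyMeasurable (hU.prodMk he).aemeasurable]
    exact (hint.indicator hB).congr (.of_forall fun ω => (hFω ω).symm)
  rw [← integral_indicator hB, ← integral_indicator hB]
  calc _ = ∫ ω, F ((C.past n ω, C.front n ω), C.increment n ω) ∂P := by simp_rw [hFω]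
    _ = ∫ q, F q ∂((P.map (fun ω => (C.past n ω, C.front n ω))).prod
          (complexGaussian c.σe2)) := by
        rw [← hprod, integral_map (hU.prodMk he).aemeasurable hFm.aestronglyMeasurable]
    _ = ∫ ω, (∫ e, F ((C.past n ω, C.front n ω), e) ∂complexGaussian c.σe2) ∂P := by
        rw [integral_prod _ hFint, integral_map hU.aemeasurable]
        exact hFint.integral_prod_left.aestronglyMeasurable
    _ = _ := by
        congr 1
        ext ω
        simp only [hF]
        rw [integral_const_mul, c.integral_rate_given_estimate hf]
        by_cases h : (C.past n ω, C.front n ω) ∈ S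
        · rw [Set.indicator_of_mem h, Set.indicator_of_mem (show ω ∈ (fun ω => (C.past n ω, C.front n ω)) ⁻¹' S from h), one_mul]
          rfl
        · rw [Set.indicator_of_notMem h, Set.indicator_of_notMem (show ω ∉ (fun ω => (C.past n ω, C.front n ω)) ⁻¹' S from h),
            zero_mul]

end Channel

/-! ### Information, adapted decisions and accounting by rounds -/

namespace Strategy
variable {c : Params} {Ω : Type*} [MeasurableSpace Ω] {P : Measure Ω} (C : Channel c P)

lemma measurable_comap_past {n j : ℕ} (hj : j < n) :
    Measurable[MeasurableSpace.comap (C.past n) inferInstance] (C.round j) := by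
  have h : Measurable[MeasurableSpace.comap (C.past n) inferInstance] (C.past n) :=
    comap_measurable _
  exact (measurable_pi_apply (⟨j, Finset.mem_range.mpr hj⟩ : Finset.range n)).comp h

lemma comap_past_mono {m n : ℕ} (h : m ≤ n) :
    MeasurableSpace.comap (C.past m) inferInstance ≤
      MeasurableSpace.comap (C.past n) inferInstance := by
  apply Measurable.comap_le
  exact @measurable_pi_lambda _ _ _ (MeasurableSpace.comap (C.past n) inferInstance) _ _
    fun j => measurable_comap_past C ((Finset.mem_range.mp j.2).trans_le h)

/-- The σ-algebra of the past rounds and of the contention and first-level estimate of round `n`. -/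
@[reducible] noncomputable def frontInfo (n : ℕ) : MeasurableSpace Ω :=
  MeasurableSpace.comap (fun ω => (C.past n ω, C.front n ω)) inferInstance

lemma comap_past_le_frontInfo (n : ℕ) :
    MeasurableSpace.comap (C.past n) inferInstance ≤ frontInfo C n := by
  apply Measurable.comap_le
  have h : Measurable[frontInfo C n] (fun ω => (C.past n ω, C.front n ω)) := comap_measurable _
  exact measurable_fst.comp h

lemma measurable_front_frontInfo (n : ℕ) : Measurable[frontInfo C n] (C.front n) := by
  have h : Measurable[frontInfo C n] (fun ω => (C.past n ω, C.front n ω)) := comap_measurable _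
  exact measurable_snd.comp h

lemma frontInfo_le_comap_past (n : ℕ) :
    frontInfo C n ≤ MeasurableSpace.comap (C.past (n + 1)) inferInstance := by
  apply Measurable.comap_le
  have h1 : Measurable[MeasurableSpace.comap (C.past (n + 1)) inferInstance] (C.past n) :=
    (comap_measurable (C.past n)).mono (comap_past_mono C n.le_succ) le_rfl
  have h2 := measurable_comap_past C n.lt_succ_self
  have h3 : Measurable[MeasurableSpace.comap (C.past (n + 1)) inferInstance] (C.front n) := by
    have hs := Channel.measurable_summary (c := c)
    exact (hs.fst.prodMk hs.snd.fst).comp h2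
  exact h1.prodMk h3

lemma measurable_R1_frontInfo (n : ℕ) : Measurable[frontInfo C n] (C.R1 n) := by
  have hg : Measurable (fun p : ℕ × ℂ => c.ρ * c.W * c.σ₁ * ‖p.2‖ ^ 2) := by fun_prop
  exact hg.comp (measurable_front_frontInfo C n)

lemma measurable_R2_past {n j : ℕ} (hj : j < n) :
    Measurable[MeasurableSpace.comap (C.past n) inferInstance] (C.R2 j) := by
  have hs := c.measurable_secondEstimate
  have hg : Measurable (fun r : ℕ × ℂ × (Fin (2 * c.M) → ℂ) =>
    c.ρ * c.W * c.σ₂ * ‖c.secondEstimate r.2‖ ^ 2) := by fun_prop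
  have h : C.R2 j = (fun r : ℕ × ℂ × (Fin (2 * c.M) → ℂ) =>
      c.ρ * c.W * c.σ₂ * ‖c.secondEstimate r.2‖ ^ 2) ∘ C.round j := by
    ext ω
    simp only [Channel.R2, C.hhat2_eq]
    rfl
  rw [h]
  exact hg.comp (measurable_comap_past C hj)

lemma comap_past_le (n : ℕ) :
    MeasurableSpace.comap (C.past n) inferInstance ≤ ‹MeasurableSpace Ω› :=
  (C.measurable_past n).comap_le

lemma frontInfo_le (n : ℕ) : frontInfo C n ≤ ‹MeasurableSpace Ω› :=
  (frontInfo_le_comap_past C n).trans (comap_past_le C _)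

variable {C} {s : Strategy Ω}

/-- The information depends on the strategy itself through the earlier decisions to probe. Strong
induction makes those measurable and bounds the information by a σ-algebra independent of the
strategy. -/
lemma IsAdapted.info1_le (hs : s.IsAdapted C) (n : ℕ) : info1 C s n ≤ frontInfo C n := by
  induction n using Nat.strong_induction_on with
  | _ n ih =>
    refine sup_le (iSup₂_le fun j hj => ?_) (iSup₂_le fun j hj => ?_)
    · have hle : frontInfo C j ≤ frontInfo C n := by
        rcases hj.lt_or_eq with h | rfl
        · exact (frontInfo_le_comap_past C j).trans
            ((comap_past_mono C h).trans (comap_past_le_frontInfo C n))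
        · exact le_rfl
      refine sup_le ?_ ?_
      · refine (Measurable.comap_le ?_).trans hle
        exact measurable_fst.comp (measurable_front_frontInfo C j)
      · exact (measurable_R1_frontInfo C j).comap_le.trans hle
    · refine le_trans (Measurable.comap_le ?_) (comap_past_le_frontInfo C n)
      have h1 : Measurable[MeasurableSpace.comap (C.past n) inferInstance] (s.φ j) :=
        (hs j).1.mono ((ih j hj).trans ((frontInfo_le_comap_past C j).trans
          (comap_past_mono C hj))) le_rfl
      exact Measurable.ite (h1 (measurableSet_singleton 2)) (measurable_R2_past C hj)
        measurable_const

lemma IsAdapted.measurable_φ (hs : s.IsAdapted C) (n : ℕ) : Measurable[frontInfo C n] (s.φ n) :=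
  (hs n).1.mono (hs.info1_le n) le_rfl

lemma IsAdapted.measurable_ψ (hs : s.IsAdapted C) (n : ℕ) :
    Measurable[MeasurableSpace.comap (C.past (n + 1)) inferInstance] (s.ψ n) := by
  refine (hs n).2.mono (sup_le ((hs.info1_le n).trans (frontInfo_le_comap_past C n)) ?_) le_rfl
  exact (measurable_R2_past C n.lt_succ_self).comap_le

/-- No data have been transmitted before round `n`. -/
def active (s : Strategy Ω) (n : ℕ) : Set Ω := {ω | ∀ j < n, ¬ s.Stops j ω}

lemma measurableSet_φ (hs : s.IsAdapted C) (n : ℕ) (i : Fin 3) :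
    MeasurableSet[frontInfo C n] {ω | s.φ n ω = i} :=
  hs.measurable_φ n (measurableSet_singleton i)

lemma measurableSet_stops (hs : s.IsAdapted C) (n : ℕ) :
    MeasurableSet[MeasurableSpace.comap (C.past (n + 1)) inferInstance] {ω | s.Stops n ω} :=
  MeasurableSet.union (frontInfo_le_comap_past C n _ (measurableSet_φ hs n 1))
    (MeasurableSet.inter (frontInfo_le_comap_past C n _ (measurableSet_φ hs n 2))
      (hs.measurable_ψ n (measurableSet_singleton 1)))

lemma measurableSet_active (hs : s.IsAdapted C) (n : ℕ) :
    MeasurableSet[MeasurableSpace.comap (C.past n) inferInstance] (s.active n) := by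
  have : s.active n = ⋂ j, ⋂ _ : j < n, {ω | s.Stops j ω}ᶜ := by
    ext ω; simp [active]
  rw [this]
  exact MeasurableSet.iInter fun j => MeasurableSet.iInter fun hj =>
    (comap_past_mono C hj _ (measurableSet_stops hs j)).compl

lemma active_succ (s : Strategy Ω) (n : ℕ) : s.active (n + 1) = s.active n \ {ω | s.Stops n ω} := by
  ext ω
  simp only [active, Set.mem_ofPred_eq, Set.mem_sdiff, Nat.lt_succ_iff_lt_or_eq, or_imp,
    forall_and, forall_eq]

variable (C) in
/-- The amount of data transmitted in round `n`. -/
noncomputable def gain (s : Strategy Ω) (n : ℕ) (ω : Ω) : ℝ := s.rate C n ω * s.txTime c n ω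

open Classical in
variable (C) in
/-- The time spent in round `n`. -/
noncomputable def cost (s : Strategy Ω) (n : ℕ) (ω : Ω) : ℝ :=
  (C.K n ω : ℝ) * c.τ + (if s.φ n ω = 2 then c.τ else 0) +
    (if s.Stops n ω then s.txTime c n ω else 0)

lemma txTime_mem (s : Strategy Ω) (n : ℕ) (ω : Ω) :
    0 ≤ s.txTime c n ω ∧ s.txTime c n ω ≤ 1 := by
  have := c.τ_pos; have := c.τ_lt
  unfold txTime
  split_ifs <;> constructor <;> linarith

lemma gain_nonneg (s : Strategy Ω) (n : ℕ) (ω : Ω) : 0 ≤ s.gain C n ω := by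
  have h1 := C.R1_nonneg n ω
  have h2 := C.R2_nonneg n ω
  refine mul_nonneg ?_ (txTime_mem s n ω).1
  unfold rate
  split_ifs <;> linarith

lemma gain_le (s : Strategy Ω) (n : ℕ) (ω : Ω) : s.gain C n ω ≤ C.R1 n ω + C.R2 n ω := by
  have h1 := C.R1_nonneg n ω
  have h2 := C.R2_nonneg n ω
  have h3 := txTime_mem (c := c) s n ω
  have h4 : s.rate C n ω ≤ C.R1 n ω + C.R2 n ω := by
    unfold rate
    split_ifs <;> linarith
  exact (mul_le_mul_of_nonneg_right h4 h3.1).trans (mul_le_of_le_one_right (by linarith) h3.2)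

lemma cost_nonneg (s : Strategy Ω) (n : ℕ) (ω : Ω) : 0 ≤ s.cost C n ω := by
  have h3 := txTime_mem (c := c) s n ω
  have := c.τ_pos
  unfold cost
  have := mul_nonneg (Nat.cast_nonneg (α := ℝ) (C.K n ω)) this.le
  split_ifs <;> linarith

lemma cost_le (s : Strategy Ω) (n : ℕ) (ω : Ω) : s.cost C n ω ≤ C.K n ω * c.τ + (c.τ + 1) := by
  have h3 := txTime_mem (c := c) s n ω
  have := c.τ_pos
  unfold cost
  split_ifs <;> linarith

lemma gain_of_not_stops {n : ℕ} {ω : Ω} (h : ¬ s.Stops n ω) : s.gain C n ω = 0 := by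
  simp only [Stops, not_or] at h
  simp [gain, rate, h]

lemma stopRound_stops {ω : Ω} (h : ∃ n, s.Stops n ω) : s.Stops (s.stopRound ω) ω := Nat.sInf_mem h

lemma mem_active_iff {ω : Ω} (h : ∃ n, s.Stops n ω) (n : ℕ) :
    ω ∈ s.active n ↔ n ≤ s.stopRound ω := by
  constructor
  · intro ha
    by_contra! hlt
    exact ha _ hlt (stopRound_stops h)
  · intro hle j hj
    exact fun hst => absurd (Nat.sInf_le hst) (not_le.mpr (hj.trans_le hle))

/-- Only the stopping round contributes: earlier rounds transmit nothing and later rounds are not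
active. -/
lemma hasSum_gain {ω : Ω} (h : ∃ n, s.Stops n ω) :
    HasSum (fun n => (s.active n).indicator (s.gain C n) ω)
      (s.rate C (s.stopRound ω) ω * s.txTime c (s.stopRound ω) ω) := by
  have : (s.active (s.stopRound ω)).indicator (s.gain C (s.stopRound ω)) ω =
      s.rate C (s.stopRound ω) ω * s.txTime c (s.stopRound ω) ω :=
    Set.indicator_of_mem ((mem_active_iff h _).mpr le_rfl) _
  rw [← this]
  refine hasSum_single _ fun n hn => ?_
  by_cases ha : ω ∈ s.active n
  · rw [Set.indicator_of_mem ha]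
    have hlt := lt_of_le_of_ne ((mem_active_iff h n).mp ha) hn
    exact gain_of_not_stops fun hst => absurd (Nat.sInf_le hst) (not_le.mpr hlt)
  · exact Set.indicator_of_notMem ha _

open Classical in
lemma hasSum_cost {ω : Ω} (h : ∃ n, s.Stops n ω) :
    HasSum (fun n => (s.active n).indicator (s.cost C n) ω) (s.sysTime C (s.stopRound ω) ω) := by
  have : s.sysTime C (s.stopRound ω) ω =
      ∑ n ∈ Finset.range (s.stopRound ω + 1), (s.active n).indicator (s.cost C n) ω := by
    have hin : ∀ n ∈ Finset.range (s.stopRound ω + 1), (s.active n).indicator (s.cost C n) ω =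
        s.cost C n ω := fun n hn => Set.indicator_of_mem
      ((mem_active_iff h n).mpr (Nat.lt_succ_iff.mp (Finset.mem_range.mp hn))) _
    rw [Finset.sum_congr rfl hin]
    simp only [cost, sysTime]
    rw [Finset.sum_add_distrib (g := fun n => if s.Stops n ω then s.txTime c n ω else 0)]
    congr 1
    rw [Finset.sum_range_succ, if_pos (stopRound_stops h), Finset.sum_eq_zero, zero_add]
    intro n hn
    exact if_neg fun hst => absurd (Nat.sInf_le hst) (not_le.mpr (Finset.mem_range.mp hn))
  rw [this]
  refine hasSum_sum_of_ne_finset_zero fun n hn => Set.indicator_of_notMem (fun ha => hn ?_) _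
  exact Finset.mem_range.mpr (Nat.lt_succ_iff.mpr ((mem_active_iff h n).mp ha))

lemma measurable_txTime (hs : s.IsAdapted C) (n : ℕ) : Measurable (s.txTime c n) := by
  refine measurable_const.sub (Measurable.ite (MeasurableSet.inter ?_ ?_) measurable_const
    measurable_const)
  · exact frontInfo_le C n _ (measurableSet_φ hs n 2)
  · exact comap_past_le C _ _ (hs.measurable_ψ n (measurableSet_singleton 1))

lemma measurable_gain (hs : s.IsAdapted C) (n : ℕ) : Measurable (s.gain C n) := by
  refine Measurable.mul (Measurable.add ?_ ?_) (measurable_txTime hs n)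
  · exact Measurable.ite (frontInfo_le C n _ (measurableSet_φ hs n 1)) (C.measurable_R1 n)
      measurable_const
  · exact Measurable.ite (MeasurableSet.inter (frontInfo_le C n _ (measurableSet_φ hs n 2))
      (comap_past_le C _ _ (hs.measurable_ψ n (measurableSet_singleton 1)))) (C.measurable_R2 n)
      measurable_const

lemma measurable_cost (hs : s.IsAdapted C) (n : ℕ) : Measurable (s.cost C n) := by
  have hK := C.measurable_K n
  refine Measurable.add (Measurable.add (by fun_prop) ?_) ?_
  · exact Measurable.ite (frontInfo_le C n _ (measurableSet_φ hs n 2)) measurable_const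
      measurable_const
  · exact Measurable.ite (comap_past_le C _ _ (measurableSet_stops hs n))
      (measurable_txTime hs n) measurable_const

/-! ### Net reward of a round when time has a price -/

variable [IsProbabilityMeasure P]

lemma integrable_gain (hs : s.IsAdapted C) (n : ℕ) : Integrable (s.gain C n) P := by
  refine ((C.integrable_R1 n).add (C.integrable_R2 n)).mono'
    (measurable_gain hs n).aestronglyMeasurable (.of_forall fun ω => ?_)
  rw [Real.norm_of_nonneg (gain_nonneg s n ω)]
  exact gain_le s n ω

lemma integrable_cost (hs : s.IsAdapted C) (n : ℕ) : Integrable (s.cost C n) P := by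
  refine (((C.integrable_K n).mul_const c.τ).add (integrable_const (c.τ + 1))).mono'
    (measurable_cost hs n).aestronglyMeasurable (.of_forall fun ω => ?_)
  rw [Real.norm_of_nonneg (cost_nonneg s n ω)]
  exact cost_le s n ω

lemma measurableSet_active' (hs : s.IsAdapted C) (n : ℕ) : MeasurableSet (s.active n) :=
  comap_past_le C n _ (measurableSet_active hs n)

/-- The expected net reward of decision `i` on observing the first-level rate `x`, when time costs
`θ` and re-contending is worth `0`. -/
noncomputable def payoff (c : Params) (θ : ℝ) (i : Fin 3) (x : ℝ) : ℝ :=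
  if i = 1 then x - θ else if i = 2 then c.J θ x 0 else 0

/-- The net reward of decision `φ` in round `n` when the second-level rate is accepted if and only
if it exceeds `θ`. -/
noncomputable def netReward (C : Channel c P) (s : Strategy Ω) (θ : ℝ) (n : ℕ) (ω : Ω) : ℝ :=
  {ω | s.φ n ω = 1}.indicator (fun ω => C.R1 n ω - θ) ω +
    {ω | s.φ n ω = 2}.indicator (fun ω => (1 - c.τ) * max (C.R2 n ω - θ) 0 - θ * c.τ) ω

/-- After probing, transmitting for time `1 - τ` nets `(1 - τ) (R⁽²⁾ - θ)` and giving up nets `0`,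
so accepting exactly above `θ` is best. -/
lemma gain_sub_cost_le (s : Strategy Ω) (θ : ℝ) (n : ℕ) (ω : Ω) :
    s.gain C n ω - θ * s.cost C n ω ≤ netReward C s θ n ω - θ * c.τ * C.K n ω := by
  have h0 := c.one_sub_τ_pos
  have h1 := mul_le_mul_of_nonneg_left (le_max_left (C.R2 n ω - θ) 0) h0.le
  have h2 := mul_nonneg h0.le (le_max_right (C.R2 n ω - θ) 0)
  by_cases hφ : s.φ n ω = 1
  · simp [gain, cost, netReward, rate, txTime, Stops, hφ, Set.indicator]
    linarith
  by_cases hφ2 : s.φ n ω = 2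
  · by_cases hψ : s.ψ n ω = 1
    · simp [gain, cost, netReward, rate, txTime, Stops, hφ2, hψ, Set.indicator]
      linarith
    · simp [gain, cost, netReward, rate, txTime, Stops, hφ2, hψ, Set.indicator]
      linarith
  · simp [gain, cost, netReward, rate, txTime, Stops, hφ2, hφ, Set.indicator]
    linarith

lemma gain_sub_cost_eq {s : Strategy Ω} {θ : ℝ} {n : ℕ} {ω : Ω}
    (h : s.φ n ω = 2 → (s.ψ n ω = 1 ↔ θ < C.R2 n ω)) :
    s.gain C n ω - θ * s.cost C n ω = netReward C s θ n ω - θ * c.τ * C.K n ω := by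
  by_cases hφ : s.φ n ω = 1
  · simp [gain, cost, netReward, rate, txTime, Stops, hφ, Set.indicator]
    ring
  by_cases hφ2 : s.φ n ω = 2
  · by_cases hψ : s.ψ n ω = 1
    · simp [gain, cost, netReward, rate, txTime, Stops, hφ2, hψ, Set.indicator]
      rw [max_eq_left (by linarith [(h hφ2).mp hψ])]
      ring
    · simp [gain, cost, netReward, rate, txTime, Stops, hφ2, hψ, Set.indicator]
      rw [max_eq_right (by linarith [not_lt.mp (fun h' => hψ ((h hφ2).mpr h'))])]
      ring
  · simp [gain, cost, netReward, rate, txTime, Stops, hφ2, hφ, Set.indicator]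
    ring

lemma integrable_positive_part (C : Channel c P) (θ : ℝ) (n : ℕ) :
    Integrable (fun ω => max (C.R2 n ω - θ) 0) P :=
  ((C.integrable_R2 n).sub (integrable_const θ)).pos_part

lemma continuous_J (c : Params) (θ : ℝ) : Continuous (fun x => c.J θ x 0) := by
  have := c.continuous_overshoot θ
  simp only [c.J_eq]
  fun_prop

lemma abs_J_le (c : Params) {θ : ℝ} (hθ : 0 ≤ θ) {x : ℝ} (hx : 0 ≤ x) :
    |c.J θ x 0| ≤ c.cr * x + c.Re + θ := by
  have h1 := c.overshoot_eq_add_undershoot θ hx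
  have h2 := c.undershoot_le hθ x
  have h3 := c.overshoot_nonneg θ x
  have h4 := c.τ_pos
  have h5 := c.τ_lt
  rw [c.J_eq, abs_le]
  constructor <;> nlinarith

lemma integrable_J (C : Channel c P) {θ : ℝ} (hθ : 0 ≤ θ) (n : ℕ) :
    Integrable (fun ω => c.J θ (C.R1 n ω) 0) P := by
  refine ((((C.integrable_R1 n).const_mul c.cr).add (integrable_const c.Re)).add
    (integrable_const θ)).mono' ?_ (.of_forall fun ω => abs_J_le c hθ (C.R1_nonneg n ω))
  exact ((continuous_J c θ).measurable.comp (C.measurable_R1 n)).aestronglyMeasurable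

lemma payoff_eq (θ : ℝ) (n : ℕ) (ω : Ω) : payoff c θ (s.φ n ω) (C.R1 n ω) =
    {ω | s.φ n ω = 1}.indicator (fun ω => C.R1 n ω - θ) ω +
      {ω | s.φ n ω = 2}.indicator (fun ω => c.J θ (C.R1 n ω) 0) ω := by
  by_cases hφ : s.φ n ω = 1
  · simp [payoff, hφ, Set.indicator]
  · simp [payoff, hφ, Set.indicator]

lemma integrable_payoff (hs : s.IsAdapted C) {θ : ℝ} (hθ : 0 ≤ θ) (n : ℕ) :
    Integrable (fun ω => payoff c θ (s.φ n ω) (C.R1 n ω)) P := by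
  simp only [payoff_eq]
  exact (((C.integrable_R1 n).sub (integrable_const θ)).indicator
    (frontInfo_le C n _ (measurableSet_φ hs n 1))).add
    ((integrable_J C hθ n).indicator (frontInfo_le C n _ (measurableSet_φ hs n 2)))

lemma integrable_netReward (hs : s.IsAdapted C) (θ : ℝ) (n : ℕ) :
    Integrable (netReward C s θ n) P :=
  (((C.integrable_R1 n).sub (integrable_const θ)).indicator
    (frontInfo_le C n _ (measurableSet_φ hs n 1))).add
    ((((integrable_positive_part C θ n).const_mul _).sub (integrable_const _)).indicator
      (frontInfo_le C n _ (measurableSet_φ hs n 2)))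

/-- Being active and deciding to probe are known before `R⁽²⁾` is seen, so its conditional law given
the first-level rate may be inserted. -/
lemma setIntegral_netReward (hs : s.IsAdapted C) {θ : ℝ} (hθ : 0 ≤ θ) (n : ℕ) :
    ∫ ω in s.active n, netReward C s θ n ω ∂P =
      ∫ ω in s.active n, payoff c θ (s.φ n ω) (C.R1 n ω) ∂P := by
  have hA := measurableSet_active' hs n
  have h1 := frontInfo_le C n _ (measurableSet_φ hs n 1)
  have h2 := frontInfo_le C n _ (measurableSet_φ hs n 2)
  have hB : MeasurableSet[frontInfo C n] (s.active n ∩ {ω | s.φ n ω = 2}) :=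
    MeasurableSet.inter (comap_past_le_frontInfo C n _ (measurableSet_active hs n))
      (measurableSet_φ hs n 2)
  have i1 : Integrable ({ω | s.φ n ω = 1}.indicator (fun ω => C.R1 n ω - θ)) P :=
    ((C.integrable_R1 n).sub (integrable_const θ)).indicator h1
  have i2 : Integrable (fun ω => (1 - c.τ) * max (C.R2 n ω - θ) 0 - θ * c.τ) P :=
    ((integrable_positive_part C θ n).const_mul _).sub (integrable_const _)
  simp only [payoff_eq, netReward]
  rw [integral_add i1.integrableOn (i2.indicator h2).integrableOn,
    integral_add i1.integrableOn ((integrable_J C hθ n).indicator h2).integrableOn]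
  congr 1
  rw [setIntegral_indicator h2, setIntegral_indicator h2]
  have := C.setIntegral_R2_eq (f := fun y => (1 - c.τ) * max (y - θ) 0 - θ * c.τ)
    (by fun_prop) i2 hB
  rw [this]
  congr 1
  ext ω
  rw [integral_sub ((c.integrable_overshoot _ _).const_mul _) (integrable_const _),
    integral_const_mul, c.J_eq]
  simp [Params.overshoot]

/-- The expected value of a round when time costs `θ`, before the contention is paid for. -/
noncomputable def roundValue (C : Channel c P) (θ : ℝ) : ℝ :=
  ∫ x, max (max (x - θ) (c.J θ x 0)) 0 ∂C.firstRateLaw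

lemma payoff_le (c : Params) (θ : ℝ) (i : Fin 3) (x : ℝ) :
    payoff c θ i x ≤ max (max (x - θ) (c.J θ x 0)) 0 := by
  unfold payoff
  split_ifs
  · exact (le_max_left _ _).trans (le_max_left _ _)
  · exact (le_max_right _ _).trans (le_max_left _ _)
  · exact le_max_right _ _

lemma integrable_value (C : Channel c P) {θ : ℝ} (hθ : 0 ≤ θ) (n : ℕ) :
    Integrable (fun ω => max (max (C.R1 n ω - θ) (c.J θ (C.R1 n ω) 0)) 0) P :=
  (((C.integrable_R1 n).sub (integrable_const θ)).sup (integrable_J C hθ n)).pos_part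

lemma measurable_value (c : Params) (θ : ℝ) :
    Measurable (fun x => max (max (x - θ) (c.J θ x 0)) 0) := by
  have := (continuous_J c θ).measurable
  fun_prop

/-- Reaching round `n` is decided by the past, while the best value depends on the signals of round
`n` only. -/
lemma setIntegral_value (hs : s.IsAdapted C) (θ : ℝ) (n : ℕ) :
    ∫ ω in s.active n, max (max (C.R1 n ω - θ) (c.J θ (C.R1 n ω) 0)) 0 ∂P =
      P.real (s.active n) * roundValue C θ := by
  have hf : Measurable (fun r : ℕ × ℂ × (Fin (2 * c.M) → ℂ) =>
      c.ρ * c.W * c.σ₁ * ‖c.firstEstimate r.2‖ ^ 2) := by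
    have := c.measurable_firstEstimate
    fun_prop
  have := C.setIntegral_round_eq ((measurable_value c θ).comp hf) (measurableSet_active hs n)
  rw [roundValue, C.integral_firstRateLaw (measurable_value c θ) n]
  exact this

lemma setIntegral_K (hs : s.IsAdapted C) (n : ℕ) :
    ∫ ω in s.active n, (C.K n ω : ℝ) ∂P = P.real (s.active n) * (1 / c.ps) := by
  have := C.setIntegral_round_eq (g := fun r => (r.1 : ℝ)) (by fun_prop) (measurableSet_active hs n)
  rw [← C.integral_K n]
  exact this

lemma setIntegral_netReward_sub (hs : s.IsAdapted C) {θ : ℝ} (hθ : 0 ≤ θ) (n : ℕ) :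
    ∫ ω in s.active n, (netReward C s θ n ω - θ * c.τ * C.K n ω) ∂P =
      ∫ ω in s.active n, payoff c θ (s.φ n ω) (C.R1 n ω) ∂P -
        P.real (s.active n) * (θ * c.τ / c.ps) := by
  rw [integral_sub (integrable_netReward hs θ n).integrableOn
    ((C.integrable_K n).const_mul _).integrableOn, setIntegral_netReward hs hθ,
    integral_const_mul, setIntegral_K hs]
  ring

lemma setIntegral_gain_sub (hs : s.IsAdapted C) (θ : ℝ) (n : ℕ) :
    ∫ ω in s.active n, (s.gain C n ω - θ * s.cost C n ω) ∂P =
      ∫ ω in s.active n, s.gain C n ω ∂P - θ * ∫ ω in s.active n, s.cost C n ω ∂P := by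
  rw [integral_sub (integrable_gain hs n).integrableOn
    ((integrable_cost hs n).const_mul _).integrableOn, integral_const_mul]

/-- A single round earns at most `θ` times the time it takes, if `θ` balances the value of a round
and the cost of contention. -/
lemma setIntegral_gain_le (hs : s.IsAdapted C) {θ : ℝ} (hθ : 0 ≤ θ)
    (hbal : roundValue C θ = θ * c.τ / c.ps) (n : ℕ) :
    ∫ ω in s.active n, s.gain C n ω ∂P ≤ θ * ∫ ω in s.active n, s.cost C n ω ∂P := by
  rw [← sub_nonpos, ← setIntegral_gain_sub hs]
  have h1 : ∫ ω in s.active n, (s.gain C n ω - θ * s.cost C n ω) ∂P ≤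
      ∫ ω in s.active n, (netReward C s θ n ω - θ * c.τ * C.K n ω) ∂P :=
    setIntegral_mono ((integrable_gain hs n).sub ((integrable_cost hs n).const_mul _)).integrableOn
      ((integrable_netReward hs θ n).sub ((C.integrable_K n).const_mul _)).integrableOn
      (gain_sub_cost_le s θ n)
  have h2 : ∫ ω in s.active n, payoff c θ (s.φ n ω) (C.R1 n ω) ∂P ≤
      ∫ ω in s.active n, max (max (C.R1 n ω - θ) (c.J θ (C.R1 n ω) 0)) 0 ∂P :=
    setIntegral_mono (integrable_payoff hs hθ n).integrableOn (integrable_value C hθ n).integrableOn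
      (fun ω => payoff_le c θ _ _)
  rw [setIntegral_netReward_sub hs hθ] at h1
  rw [setIntegral_value hs, hbal] at h2
  linarith

/-- The decisions are, in every round, best responses when time costs `θ`. -/
def IsGreedy (C : Channel c P) (s : Strategy Ω) (θ : ℝ) : Prop :=
  ∀ n ω, payoff c θ (s.φ n ω) (C.R1 n ω) =
      max (max (C.R1 n ω - θ) (c.J θ (C.R1 n ω) 0)) 0 ∧
    (s.φ n ω = 2 → (s.ψ n ω = 1 ↔ θ < C.R2 n ω))

lemma IsGreedy.setIntegral_gain_eq {θ : ℝ} (hg : IsGreedy C s θ) (hs : s.IsAdapted C) (hθ : 0 ≤ θ)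
    (hbal : roundValue C θ = θ * c.τ / c.ps) (n : ℕ) :
    ∫ ω in s.active n, s.gain C n ω ∂P = θ * ∫ ω in s.active n, s.cost C n ω ∂P := by
  rw [← sub_eq_zero, ← setIntegral_gain_sub hs]
  simp_rw [gain_sub_cost_eq (hg n _).2]
  rw [setIntegral_netReward_sub hs hθ]
  simp_rw [(hg n _).1]
  rw [setIntegral_value hs, hbal, sub_self]

/-! ### From single rounds to the throughput -/

lemma le_sysTime (s : Strategy Ω) (n : ℕ) (ω : Ω) : 1 - c.τ ≤ s.sysTime C n ω := by
  have hτ := c.τ_pos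
  have h1 : 1 - c.τ ≤ s.txTime c n ω := by
    unfold txTime
    split_ifs <;> linarith
  have h2 : 0 ≤ ∑ j ∈ Finset.range (n + 1),
      ((C.K j ω : ℝ) * c.τ + (if s.φ j ω = 2 then c.τ else 0)) :=
    Finset.sum_nonneg fun j _ => by split_ifs <;> positivity
  unfold sysTime
  linarith

lemma integrable_indicator_gain (hs : s.IsAdapted C) (n : ℕ) :
    Integrable ((s.active n).indicator (s.gain C n)) P :=
  (integrable_gain hs n).indicator (measurableSet_active' hs n)

lemma integrable_indicator_cost (hs : s.IsAdapted C) (n : ℕ) :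
    Integrable ((s.active n).indicator (s.cost C n)) P :=
  (integrable_cost hs n).indicator (measurableSet_active' hs n)

lemma hasSum_integral_of_nonneg {F : ℕ → Ω → ℝ} {f : Ω → ℝ} (hF : ∀ n, Integrable (F n) P)
    (hF0 : ∀ n ω, 0 ≤ F n ω) (hsum : Summable fun n => ∫ ω, F n ω ∂P)
    (hf : ∀ᵐ ω ∂P, HasSum (fun n => F n ω) (f ω)) :
    HasSum (fun n => ∫ ω, F n ω ∂P) (∫ ω, f ω ∂P) := by
  have h := hasSum_integral_of_summable_integral_norm hF
    (hsum.congr fun n => integral_congr_ae (.of_forall fun ω =>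
      (Real.norm_of_nonneg (hF0 n ω)).symm))
  rwa [integral_congr_ae (hf.mono fun ω hω => hω.tsum_eq)] at h

lemma hasSum_integral_gain (hs : s.IsAdapted C) (hst : ∀ᵐ ω ∂P, ∃ n, s.Stops n ω)
    (hsum : Summable fun n => ∫ ω in s.active n, s.gain C n ω ∂P) :
    HasSum (fun n => ∫ ω in s.active n, s.gain C n ω ∂P)
      (∫ ω, s.rate C (s.stopRound ω) ω * s.txTime c (s.stopRound ω) ω ∂P) := by
  simp_rw [← fun n => integral_indicator (f := s.gain C n) (μ := P)
    (measurableSet_active' hs n)] at hsum ⊢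
  exact hasSum_integral_of_nonneg (integrable_indicator_gain hs)
    (fun n ω => Set.indicator_nonneg (fun ω _ => gain_nonneg s n ω) ω) hsum
    (hst.mono fun ω hω => hasSum_gain hω)

lemma hasSum_integral_cost (hs : s.IsAdapted C) (hst : ∀ᵐ ω ∂P, ∃ n, s.Stops n ω)
    (hsum : Summable fun n => ∫ ω in s.active n, s.cost C n ω ∂P) :
    HasSum (fun n => ∫ ω in s.active n, s.cost C n ω ∂P)
      (∫ ω, s.sysTime C (s.stopRound ω) ω ∂P) := by
  simp_rw [← fun n => integral_indicator (f := s.cost C n) (μ := P)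
    (measurableSet_active' hs n)] at hsum ⊢
  exact hasSum_integral_of_nonneg (integrable_indicator_cost hs)
    (fun n ω => Set.indicator_nonneg (fun ω _ => cost_nonneg s n ω) ω) hsum
    (hst.mono fun ω hω => hasSum_cost hω)

lemma IsAdmissible.summable_cost (hs : s.IsAdmissible C) :
    Summable fun n => ∫ ω in s.active n, s.cost C n ω ∂P := by
  refine summable_of_sum_range_le (c := ∫ ω, s.sysTime C (s.stopRound ω) ω ∂P)
    (fun n => integral_nonneg (cost_nonneg s n)) fun m => ?_
  simp_rw [← fun n => integral_indicator (f := s.cost C n) (μ := P)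
    (measurableSet_active' hs.1 n)]
  rw [← integral_finsetSum _ fun n _ => integrable_indicator_cost hs.1 n]
  refine integral_mono_ae (integrable_finsetSum _ fun n _ => integrable_indicator_cost hs.1 n)
    hs.2.2 ?_
  filter_upwards [hs.2.1] with ω hω
  exact sum_le_hasSum _ (fun n _ => Set.indicator_nonneg (fun ω _ => cost_nonneg s n ω) ω)
    (hasSum_cost hω)

/-- The round costs are summable because `E[T_N] < ∞`. They dominate the gains up to the factor `θ`,
so integrability of the reward comes for free and the round inequalities can be summed. -/
lemma IsAdmissible.throughput_le (hs : s.IsAdmissible C) {θ : ℝ} (hθ : 0 ≤ θ)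
    (hbal : roundValue C θ = θ * c.τ / c.ps) : s.throughput C ≤ θ := by
  have hcs := hs.summable_cost
  have hc := (hasSum_integral_cost hs.1 hs.2.1 hcs).mul_left θ
  have hgs := hc.summable.of_nonneg_of_le (fun n => integral_nonneg (gain_nonneg s n))
    (setIntegral_gain_le hs.1 hθ hbal)
  have hle := hasSum_le (setIntegral_gain_le hs.1 hθ hbal)
    (hasSum_integral_gain hs.1 hs.2.1 hgs) hc
  exact div_le_of_le_mul₀ (integral_nonneg fun ω =>
    c.one_sub_τ_pos.le.trans (le_sysTime s _ ω)) hθ hle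

/-- Whether data are transmitted in a round depends on the signals of that round only, in the same
way in every round. -/
def IsStationary (C : Channel c P) (s : Strategy Ω) : Prop :=
  ∃ S : Set (ℕ × ℂ × (Fin (2 * c.M) → ℂ)), MeasurableSet S ∧
    ∀ n ω, s.Stops n ω ↔ C.round n ω ∈ S

/-- Each further round multiplies the probability by the same factor, by independence of the past
and equality of the round laws. -/
lemma IsStationary.measureReal_active (hst : IsStationary C s) (hs : s.IsAdapted C) (n : ℕ) :
    P.real (s.active n) = P.real {ω | s.Stops 0 ω}ᶜ ^ n := by
  obtain ⟨S, hS, hst⟩ := hst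
  have hset : ∀ n, {ω | s.Stops n ω}ᶜ = C.round n ⁻¹' Sᶜ := fun n => by
    ext ω; simp [hst]
  have hq : ∀ n, P.real (C.round n ⁻¹' Sᶜ) = P.real {ω | s.Stops 0 ω}ᶜ := fun n => by
    rw [hset, ← map_measureReal_apply (C.measurable_round n) hS.compl, C.map_round n,
      map_measureReal_apply (C.measurable_round 0) hS.compl]
  induction n with
  | zero => simp [active]
  | succ n ih =>
    have h := C.setIntegral_round_eq (g := Sᶜ.indicator 1) (measurable_const.indicator hS.compl)
      (measurableSet_active hs n)
    have hi : ∀ ω, Sᶜ.indicator (1 : ℕ × ℂ × (Fin (2 * c.M) → ℂ) → ℝ) (C.round n ω) = (C.round n ⁻¹' Sᶜ).indicator 1 ω :=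
      fun ω => rfl
    simp_rw [hi] at h
    have hm : MeasurableSet (C.round n ⁻¹' Sᶜ) := C.measurable_round n hS.compl
    rw [integral_indicator_one hm, integral_indicator_one hm, measureReal_restrict_apply hm,
      hq, ih, Set.inter_comm] at h
    rw [active_succ, Set.sdiff_eq, hset, h, pow_succ]

lemma IsGreedy.isAdmissible {θ : ℝ} (hg : IsGreedy C s θ) (hst : IsStationary C s)
    (hs : s.IsAdapted C) (hθ : 0 < θ) (hbal : roundValue C θ = θ * c.τ / c.ps) :
    s.IsAdmissible C ∧ s.throughput C = θ := by
  have hmeas0 : MeasurableSet {ω | s.Stops 0 ω} := comap_past_le C _ _ (measurableSet_stops hs 0)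
  have hKpos : 0 < ∫ ω, (C.K 0 ω : ℝ) * c.τ ∂P := by
    rw [integral_mul_const, C.integral_K]
    have := c.ps_pos
    have := c.τ_pos
    positivity
  have hcost0 : 0 < ∫ ω in s.active 0, s.cost C 0 ω ∂P := by
    have : s.active 0 = Set.univ := by simp [active]
    rw [this, setIntegral_univ]
    refine hKpos.trans_le (integral_mono ((C.integrable_K 0).mul_const _)
      (integrable_cost hs 0) fun ω => ?_)
    have h3 := txTime_mem (c := c) s 0 ω
    have := c.τ_pos
    simp only [cost]
    split_ifs <;> linarith
  have hq0 : 0 ≤ P.real {ω | s.Stops 0 ω}ᶜ := measureReal_nonneg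
  -- If round `0` almost surely transmitted nothing, its expected gain would vanish, yet the balance
  -- makes it `θ` times a positive cost. Hence the survival probabilities decay geometrically.
  have hq1 : P.real {ω | s.Stops 0 ω}ᶜ < 1 := by
    refine lt_of_le_of_ne measureReal_le_one fun h1 => ?_
    have h0 : ∀ᵐ ω ∂P, ¬ s.Stops 0 ω := by
      rw [probReal_compl_eq_one_sub hmeas0, sub_eq_self, measureReal_eq_zero_iff] at h1
      exact measure_eq_zero_iff_ae_notMem.mp h1
    have h2 := hg.setIntegral_gain_eq hs hθ.le hbal 0
    rw [integral_eq_zero_of_ae] at h2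
    · have := mul_pos hθ hcost0
      linarith
    · exact ae_restrict_of_ae (h0.mono fun ω hω => gain_of_not_stops hω)
  have hgeo := summable_geometric_of_lt_one hq0 hq1
  have hcs : Summable fun n => ∫ ω in s.active n, s.cost C n ω ∂P := by
    refine (hgeo.mul_right (1 / c.ps * c.τ + (c.τ + 1))).of_nonneg_of_le
      (fun n => integral_nonneg (cost_nonneg s n)) fun n => ?_
    have h : ∫ ω in s.active n, s.cost C n ω ∂P ≤
        ∫ ω in s.active n, (C.K n ω * c.τ + (c.τ + 1)) ∂P :=
      setIntegral_mono (integrable_cost hs n).integrableOn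
        (((C.integrable_K n).mul_const _).add (integrable_const _)).integrableOn (cost_le s n)
    refine h.trans_eq ?_
    rw [integral_add ((C.integrable_K n).mul_const _).integrableOn (integrable_const _),
      integral_mul_const, setIntegral_K hs, setIntegral_const, hst.measureReal_active hs n,
      smul_eq_mul]
    ring
  have hae : ∀ᵐ ω ∂P, ∃ n, s.Stops n ω := by
    have hz : P.real {ω | ¬ ∃ n, s.Stops n ω} = 0 := by
      refine le_antisymm (ge_of_tendsto' (tendsto_pow_atTop_nhds_zero_of_lt_one hq0 hq1)
        fun n => ?_) measureReal_nonneg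
      rw [← hst.measureReal_active hs n]
      exact measureReal_mono fun ω hω j _ hj => hω ⟨j, hj⟩
    rwa [measureReal_eq_zero_iff] at hz
  have hT := hasSum_integral_cost hs hae hcs
  have hTpos : 0 < ∫ ω, s.sysTime C (s.stopRound ω) ω ∂P :=
    hcost0.trans_le (le_hasSum hT 0 fun n _ => integral_nonneg (cost_nonneg s n))
  have hG : HasSum (fun n => ∫ ω in s.active n, s.gain C n ω ∂P)
      (θ * ∫ ω, s.sysTime C (s.stopRound ω) ω ∂P) := by
    simp_rw [hg.setIntegral_gain_eq hs hθ.le hbal]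
    exact hT.mul_left θ
  -- A non-integrable function has Bochner integral `0` by convention, so the positive value of
  -- `E[T_N]` yields integrability.
  refine ⟨⟨hs, hae, .of_integral_ne_zero hTpos.ne'⟩, ?_⟩
  rw [throughput, (hasSum_integral_gain hs hae hG.summable).unique hG,
    mul_div_cancel_right₀ _ hTpos.ne']

lemma IsGreedy.isOptimal {θ : ℝ} (hg : IsGreedy C s θ) (hst : IsStationary C s)
    (hs : s.IsAdapted C) (hθ : 0 < θ) (hbal : roundValue C θ = θ * c.τ / c.ps) :
    s.IsOptimal C ∧ s.throughput C = θ := by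
  obtain ⟨h1, h2⟩ := hg.isAdmissible hst hs hθ hbal
  exact ⟨⟨h1, fun s' hs' => (hs'.throughput_le hθ.le hbal).trans_eq h2.symm⟩, h2⟩

lemma IsOptimal.optThroughput_eq (h : s.IsOptimal C) : optThroughput C = s.throughput C := by
  refine IsGreatest.csSup_eq ⟨⟨s, h.1, rfl⟩, ?_⟩
  rintro _ ⟨s', hs', rfl⟩
  exact h.2 s' hs'

end Strategy

/-! ### Memoryless strategies, and crossings of a decreasing function with a line -/

namespace Strategy
variable {c : Params} {Ω : Type*} [MeasurableSpace Ω] {P : Measure Ω} {C : Channel c P}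
  {s : Strategy Ω}

/-- The decisions are fixed functions of the rates of the current round. -/
def IsMemoryless (C : Channel c P) (s : Strategy Ω) : Prop :=
  ∃ (d : ℝ → Fin 3) (p : ℝ → Fin 2), Measurable d ∧ Measurable p ∧
    (∀ n ω, s.φ n ω = d (C.R1 n ω)) ∧ ∀ n ω, s.ψ n ω = p (C.R2 n ω)

lemma IsMemoryless.isAdapted (h : IsMemoryless C s) : s.IsAdapted C := by
  obtain ⟨d, p, hd, hp, hφ, hψ⟩ := h
  intro n
  constructor
  · have h1 : MeasurableSpace.comap (C.R1 n) inferInstance ≤ info1 C s n := by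
      refine le_sup_of_le_left (le_iSup₂_of_le n le_rfl le_sup_right)
    have h2 : Measurable[info1 C s n] (C.R1 n) := (comap_measurable (C.R1 n)).mono h1 le_rfl
    rw [funext (hφ n)]
    exact hd.comp h2
  · have h1 : MeasurableSpace.comap (C.R2 n) inferInstance ≤ info2 C s n := le_sup_right
    have h2 : Measurable[info2 C s n] (C.R2 n) := (comap_measurable (C.R2 n)).mono h1 le_rfl
    rw [funext (hψ n)]
    exact hp.comp h2

lemma IsMemoryless.isStationary (h : IsMemoryless C s) : IsStationary C s := by
  obtain ⟨d, p, hd, hp, hφ, hψ⟩ := h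
  have h1 := c.measurable_firstEstimate
  have h2 := c.measurable_secondEstimate
  have hr1 : Measurable (fun r : ℕ × ℂ × (Fin (2 * c.M) → ℂ) =>
      d (c.ρ * c.W * c.σ₁ * ‖c.firstEstimate r.2‖ ^ 2)) := hd.comp (by fun_prop)
  have hr2 : Measurable (fun r : ℕ × ℂ × (Fin (2 * c.M) → ℂ) =>
      p (c.ρ * c.W * c.σ₂ * ‖c.secondEstimate r.2‖ ^ 2)) := hp.comp (by fun_prop)
  refine ⟨_, (hr1 (measurableSet_singleton 1)).union
    ((hr1 (measurableSet_singleton 2)).inter (hr2 (measurableSet_singleton 1))), fun n ω => ?_⟩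
  rw [Stops, hφ, hψ]
  simp only [Channel.R1, Channel.R2, C.hhat1_eq, C.hhat2_eq]
  rfl

lemma isMemoryless_strategyA (C : Channel c P) (xJ xq θ : ℝ) :
    IsMemoryless C (strategyA C xJ xq θ) :=
  ⟨fun x => if xq < x then 1 else if x < xJ then 0 else 2, fun y => if θ < y then 1 else 0,
    Measurable.ite measurableSet_Ioi measurable_const
      (Measurable.ite measurableSet_Iio measurable_const measurable_const),
    Measurable.ite measurableSet_Ioi measurable_const measurable_const,
    fun _ _ => rfl, fun _ _ => rfl⟩

lemma isMemoryless_strategyB (C : Channel c P) (θ : ℝ) : IsMemoryless C (strategyB C θ) :=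
  ⟨fun x => if θ < x then 1 else 0, fun _ => 0,
    Measurable.ite measurableSet_Ioi measurable_const measurable_const, measurable_const,
    fun _ _ => rfl, fun _ _ => rfl⟩

end Strategy

/-- A nonnegative antitone function with Lipschitz constant `1` meets every increasing line through
the origin. -/
lemma exists_eq_mul_of_antitone {V : ℝ → ℝ} (hanti : ∀ a b, 0 ≤ a → a ≤ b → V b ≤ V a)
    (hlip : ∀ a b, 0 ≤ a → a ≤ b → V a ≤ V b + (b - a)) (h0 : 0 < V 0) {k : ℝ} (hk : 0 < k) :
    ∃ θ, 0 < θ ∧ V θ = θ * k := by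
  have hcont : ContinuousOn V (Set.Ici 0) := by
    have : LipschitzOnWith 1 V (Set.Ici 0) := by
      refine LipschitzOnWith.of_dist_le_mul fun a ha b hb => ?_
      have ha : 0 ≤ a := ha
      have hb : 0 ≤ b := hb
      rw [Real.dist_eq, Real.dist_eq, NNReal.coe_one, one_mul]
      rcases le_total a b with h | h
      · rw [abs_of_nonneg (sub_nonneg.mpr (hanti a b ha h)), abs_of_nonpos (by linarith)]
        linarith [hlip a b ha h]
      · rw [abs_of_nonpos (sub_nonpos.mpr (hanti b a hb h)), abs_of_nonneg (by linarith)]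
        linarith [hlip b a hb h]
    exact this.continuousOn
  have hle : 0 ≤ V 0 / k := by positivity
  have hc : ContinuousOn (fun θ => θ * k - V θ) (Set.Icc 0 (V 0 / k)) :=
    (by fun_prop : Continuous fun θ : ℝ => θ * k).continuousOn.sub
      (hcont.mono Set.Icc_subset_Ici_self)
  -- At `V 0 / k` the line has height `V 0`, which antitonicity makes an upper bound for `V` there.
  obtain ⟨θ, hθ, h⟩ := intermediate_value_Icc hle hc (show (0 : ℝ) ∈ Set.Icc _ _ by
    constructor
    · linarith
    · rw [div_mul_cancel₀ _ hk.ne', sub_nonneg]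
      exact hanti 0 _ le_rfl hle)
  refine ⟨θ, lt_of_le_of_ne hθ.1 ?_, by linarith⟩
  rintro rfl
  linarith

lemma eq_of_antitone_of_eq_mul {V : ℝ → ℝ} (hanti : ∀ a b, 0 ≤ a → a ≤ b → V b ≤ V a)
    {k : ℝ} (hk : 0 < k) {a b : ℝ} (ha : 0 ≤ a) (hb : 0 ≤ b) (hVa : V a = a * k)
    (hVb : V b = b * k) : a = b := by
  rcases lt_trichotomy a b with h | h | h
  · have := hanti a b ha h.le
    have := mul_lt_mul_of_pos_right h hk
    linarith
  · exact h
  · have := hanti b a hb h.le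
    have := mul_lt_mul_of_pos_right h hk
    linarith

/-! ### Monotonicity of the probing reward and the thresholds -/

namespace Params
variable (c : Params)

lemma J_anti (x : ℝ) {a b : ℝ} (hab : a ≤ b) : c.J b x 0 ≤ c.J a x 0 := by
  have h1 := mul_le_mul_of_nonneg_left (c.overshoot_antitone x hab) c.one_sub_τ_pos.le
  have h2 := mul_le_mul_of_nonneg_right hab c.τ_pos.le
  rw [c.J_eq, c.J_eq]
  dsimp only at h1
  linarith

/-- The overshoot loses at most `(1 - τ) (b - a)` and the probing cost changes by exactly `τ (b -
a)`. -/
lemma J_le_add (x : ℝ) {a b : ℝ} (hab : a ≤ b) : c.J a x 0 ≤ c.J b x 0 + (b - a) := by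
  have h1 := mul_le_mul_of_nonneg_left (c.overshoot_sub_le x hab) c.one_sub_τ_pos.le
  rw [c.J_eq, c.J_eq]
  linarith

lemma J_strictMonoOn {θ : ℝ} (hθ : 0 ≤ θ) : StrictMonoOn (fun x => c.J θ x 0) (Set.Ici 0) := by
  intro x hx y hy hxy
  have := mul_lt_mul_of_pos_left (c.overshoot_strictMonoOn hθ hx hy hxy) c.one_sub_τ_pos
  simp only [c.J_eq]
  linarith

/-- The right side is the left side of the second equation of Strategy A, once `integral_G` is
applied; its zero is the point of indifference between probing and transmitting. -/
lemma J_sub_eq (θ : ℝ) {x : ℝ} (hx : 0 ≤ x) : c.J θ x 0 - (x - θ) =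
    (c.cr * (1 - c.τ) - 1) * x + (1 - c.τ) * (c.Re + c.undershoot θ x) := by
  rw [c.J_eq, c.overshoot_eq_add_undershoot θ hx]
  ring

variable {c}

lemma cr_mul_lt (hcr : c.cr < 1 / (1 - c.τ)) : c.cr * (1 - c.τ) - 1 < 0 :=
  sub_neg.mpr ((lt_div_iff₀ c.one_sub_τ_pos).mp hcr)

lemma J_sub_strictAntiOn (hcr : c.cr < 1 / (1 - c.τ)) (θ : ℝ) :
    StrictAntiOn (fun x => c.J θ x 0 - (x - θ)) (Set.Ici 0) := by
  intro x hx y hy hxy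
  have h1 := mul_lt_mul_of_neg_left hxy (cr_mul_lt hcr)
  have h2 := mul_le_mul_of_nonneg_left (c.undershoot_antitoneOn θ hx hy hxy.le) c.one_sub_τ_pos.le
  simp only [c.J_sub_eq θ hx, c.J_sub_eq θ hy]
  linarith

lemma exists_J_eq_sub (hcr : c.cr < 1 / (1 - c.τ)) {θ : ℝ} (hθ : 0 ≤ θ) :
    ∃ xq, 0 ≤ xq ∧ c.J θ xq 0 = xq - θ := by
  have hk := cr_mul_lt hcr
  have hτ := c.one_sub_τ_pos
  have hR := c.Re_pos
  -- Here the difference would vanish if the undershoot were replaced by its upper bound `θ`, so it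
  -- is at most `0`.
  set x₁ := (1 - c.τ) * (c.Re + θ) / (1 - c.cr * (1 - c.τ)) with hx₁
  have hx₁0 : 0 ≤ x₁ := div_nonneg (by positivity) (by linarith)
  have hx₁eq : x₁ * (1 - c.cr * (1 - c.τ)) = (1 - c.τ) * (c.Re + θ) :=
    div_mul_cancel₀ _ (by linarith)
  have hc : ContinuousOn (fun x => c.J θ x 0 - (x - θ)) (Set.Icc 0 x₁) := by
    have := Strategy.continuous_J c θ
    exact Continuous.continuousOn (by fun_prop)
  obtain ⟨x, hx, h⟩ := intermediate_value_Icc' hx₁0 hc (show (0 : ℝ) ∈ Set.Icc _ _ by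
    simp only [c.J_sub_eq θ hx₁0, c.J_sub_eq θ le_rfl]
    have h1 := mul_le_mul_of_nonneg_left (c.undershoot_le hθ x₁) hτ.le
    have h2 := mul_nonneg hτ.le (add_nonneg hR.le (c.undershoot_nonneg θ 0))
    constructor <;> linarith)
  exact ⟨x, hx.1, sub_eq_zero.mp h⟩

lemma exists_J_eq_zero {θ : ℝ} (hθ : 0 ≤ θ) (h0 : c.J θ 0 0 ≤ 0) :
    ∃ xJ, 0 ≤ xJ ∧ c.J θ xJ 0 = 0 := by
  have hτ := c.one_sub_τ_pos
  have hr := c.cr_pos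
  have hτ0 := c.τ_pos
  -- At this point the linear lower bound on the overshoot gives `J ≥ (1 - τ) R_e > 0`.
  set x₁ := (θ + θ * c.τ / (1 - c.τ)) / c.cr with hx₁
  have hx₁0 : 0 ≤ x₁ := by positivity
  obtain ⟨x, hx, h⟩ := intermediate_value_Icc hx₁0 (Strategy.continuous_J c θ).continuousOn
    (show (0 : ℝ) ∈ Set.Icc _ _ by
      refine ⟨h0, ?_⟩
      have h1 := mul_le_mul_of_nonneg_left (c.le_overshoot θ hx₁0) hτ.le
      have h2 : c.cr * x₁ = θ + θ * c.τ / (1 - c.τ) := mul_div_cancel₀ _ hr.ne'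
      have h3 : (1 - c.τ) * (θ * c.τ / (1 - c.τ)) = θ * c.τ := mul_div_cancel₀ _ hτ.ne'
      have h4 := mul_pos hτ c.Re_pos
      rw [c.J_eq]
      rw [h2] at h1
      linarith)
  exact ⟨x, hx.1, h⟩

lemma J_zero_neg {θ : ℝ} (hθ : 0 < θ)
    (h : c.Re / θ * Real.exp (-(θ / c.Re)) < c.τ / (1 - c.τ)) : c.J θ 0 0 < 0 := by
  rw [c.J_eq, c.overshoot_zero hθ.le]
  rw [div_mul_eq_mul_div, div_lt_div_iff₀ hθ c.one_sub_τ_pos] at h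
  linarith

/-- `xJ` and `xq` separate the first-level rates for which giving up, second-level probing and
immediate transmission is best when time costs `θ`. -/
structure Separates (c : Params) (xJ xq θ : ℝ) : Prop where
  nonneg : 0 ≤ xJ
  le : xJ ≤ xq
  nonpos_of_lt : ∀ x, 0 ≤ x → x < xJ → c.J θ x 0 ≤ 0
  nonneg_of_ge : ∀ x, xJ ≤ x → 0 ≤ c.J θ x 0
  sub_le_of_le : ∀ x, 0 ≤ x → x ≤ xq → x - θ ≤ c.J θ x 0
  le_sub_of_gt : ∀ x, xq < x → c.J θ x 0 ≤ x - θ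

lemma le_sub_of_gt {xq θ : ℝ} (hcr : c.cr < 1 / (1 - c.τ)) (hxq : 0 ≤ xq)
    (hq : c.J θ xq 0 = xq - θ) {x : ℝ} (hx : xq < x) : c.J θ x 0 ≤ x - θ := by
  have := J_sub_strictAntiOn hcr θ hxq (hxq.trans hx.le) hx
  dsimp only at this
  linarith

lemma sub_le_of_le {xq θ : ℝ} (hcr : c.cr < 1 / (1 - c.τ)) (hxq : 0 ≤ xq)
    (hq : c.J θ xq 0 = xq - θ) {x : ℝ} (hx0 : 0 ≤ x) (hx : x ≤ xq) : x - θ ≤ c.J θ x 0 := by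
  have := (J_sub_strictAntiOn hcr θ).antitoneOn hx0 hxq hx
  linarith

lemma separates_of_eq {xJ xq θ : ℝ} (hcr : c.cr < 1 / (1 - c.τ)) (hθ : 0 ≤ θ) (hxJ : 0 ≤ xJ)
    (hle : xJ ≤ xq) (hJ : c.J θ xJ 0 = 0) (hq : c.J θ xq 0 = xq - θ) : c.Separates xJ xq θ where
  nonneg := hxJ
  le := hle
  nonpos_of_lt x hx h := by
    have := c.J_strictMonoOn hθ hx hxJ h
    dsimp only at this
    linarith
  nonneg_of_ge x h := by
    have := (c.J_strictMonoOn hθ).monotoneOn hxJ (hxJ.trans h) h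
    linarith
  sub_le_of_le _ := sub_le_of_le hcr (hxJ.trans hle) hq
  le_sub_of_gt _ := le_sub_of_gt hcr (hxJ.trans hle) hq

/-- The degenerate configuration in which probing is worthwhile even at rate `0`, so that `xJ = 0`
need not solve `J = 0`. It serves to identify `θ*` in the case that the hypothesis then excludes. -/
lemma separates_zero {xq θ : ℝ} (hcr : c.cr < 1 / (1 - c.τ)) (hθ : 0 ≤ θ) (hxq : 0 ≤ xq)
    (hJ : 0 ≤ c.J θ 0 0) (hq : c.J θ xq 0 = xq - θ) : c.Separates 0 xq θ where
  nonneg := le_rfl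
  le := hxq
  nonpos_of_lt _ hx h := absurd h hx.not_gt
  nonneg_of_ge _ h := hJ.trans ((c.J_strictMonoOn hθ).monotoneOn Set.self_mem_Ici h h)
  sub_le_of_le _ := sub_le_of_le hcr hxq hq
  le_sub_of_gt _ := le_sub_of_gt hcr hxq hq

lemma Separates.value_eq {xJ xq θ x : ℝ} (h : c.Separates xJ xq θ) (hx : 0 ≤ x) :
    max (max (x - θ) (c.J θ x 0)) 0 =
      if xq < x then x - θ else if x < xJ then 0 else c.J θ x 0 := by
  split_ifs with h1 h2
  · rw [max_eq_left (h.le_sub_of_gt x h1)]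
    exact max_eq_left ((h.nonneg_of_ge x (h.le.trans h1.le)).trans (h.le_sub_of_gt x h1))
  · rw [max_eq_right (h.sub_le_of_le x hx (not_lt.mp h1))]
    exact max_eq_right (h.nonpos_of_lt x hx h2)
  · rw [max_eq_right (h.sub_le_of_le x hx (not_lt.mp h1))]
    exact max_eq_left (h.nonneg_of_ge x (not_lt.mp h2))

end Params

/-! ### Balance equations, uniqueness and the two optimal strategies -/

namespace Strategy
variable {c : Params} {Ω : Type*} [MeasurableSpace Ω] {P : Measure Ω} (C : Channel c P)

lemma isGreedy_strategyA {xJ xq θ : ℝ} (h : c.Separates xJ xq θ) :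
    IsGreedy C (strategyA C xJ xq θ) θ := by
  refine fun n ω => ⟨?_, fun _ => ?_⟩
  · rw [h.value_eq (C.R1_nonneg n ω)]
    simp only [strategyA, payoff]
    split_ifs <;> simp_all
  · simp [strategyA]

lemma isGreedy_strategyB {θ : ℝ} (h : ∀ x, 0 ≤ x → c.J θ x 0 ≤ max (x - θ) 0) :
    IsGreedy C (strategyB C θ) θ := by
  refine fun n ω => ⟨?_, fun h2 => ?_⟩
  · have hR := h _ (C.R1_nonneg n ω)
    rw [max_right_comm, max_eq_left hR]
    by_cases h1 : θ < C.R1 n ω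
    · have hφ : (strategyB C θ).φ n ω = 1 := if_pos h1
      rw [hφ, max_eq_left (by linarith)]
      rfl
    · have hφ : (strategyB C θ).φ n ω = 0 := if_neg h1
      rw [hφ, max_eq_right (by linarith)]
      rfl
  · simp only [strategyB] at h2
    split_ifs at h2 <;> simp at h2

variable [IsProbabilityMeasure P]

lemma roundValue_eq (θ : ℝ) :
    roundValue C θ = ∫ ω, max (max (C.R1 0 ω - θ) (c.J θ (C.R1 0 ω) 0)) 0 ∂P :=
  C.integral_firstRateLaw (measurable_value c θ) 0

lemma roundValue_anti (a b : ℝ) (ha : 0 ≤ a) (hab : a ≤ b) :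
    roundValue C b ≤ roundValue C a := by
  rw [roundValue_eq, roundValue_eq]
  refine integral_mono (integrable_value C (ha.trans hab) 0) (integrable_value C ha 0) fun ω => ?_
  exact max_le_max_right 0 (max_le_max (by linarith) (c.J_anti _ hab))

lemma roundValue_le_add (a b : ℝ) (ha : 0 ≤ a) (hab : a ≤ b) :
    roundValue C a ≤ roundValue C b + (b - a) := by
  have hb := integrable_value C (ha.trans hab) 0
  have h : ∫ ω, (max (max (C.R1 0 ω - b) (c.J b (C.R1 0 ω) 0)) 0 + (b - a)) ∂P =
      roundValue C b + (b - a) := by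
    rw [integral_add hb (integrable_const _), roundValue_eq]
    simp
  rw [← h, roundValue_eq]
  refine integral_mono (integrable_value C ha 0) (hb.add (integrable_const _)) fun ω => ?_
  have h1 := le_max_left (max (C.R1 0 ω - b) (c.J b (C.R1 0 ω) 0)) 0
  have h2 := le_max_right (max (C.R1 0 ω - b) (c.J b (C.R1 0 ω) 0)) 0
  have h3 := le_max_left (C.R1 0 ω - b) (c.J b (C.R1 0 ω) 0)
  have h4 := le_max_right (C.R1 0 ω - b) (c.J b (C.R1 0 ω) 0)
  have h5 := c.J_le_add (C.R1 0 ω) hab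
  exact max_le (max_le (by linarith) (by linarith)) (by linarith)

lemma roundValue_zero_pos : 0 < roundValue C 0 := by
  rw [roundValue_eq]
  refine C.integral_R1_pos.trans_le
    (integral_mono (C.integrable_R1 0) (integrable_value C le_rfl 0) fun ω => ?_)
  exact (sub_zero (C.R1 0 ω)).ge.trans ((le_max_left _ _).trans (le_max_left _ _))

lemma exists_balance : ∃ θ, 0 < θ ∧ roundValue C θ = θ * (c.τ / c.ps) :=
  exists_eq_mul_of_antitone (roundValue_anti C) (roundValue_le_add C) (roundValue_zero_pos C)
    (div_pos c.τ_pos c.ps_pos)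

/-- The expected value of a round without second-level probing. -/
noncomputable def directValue (θ : ℝ) : ℝ := ∫ ω, max (C.R1 0 ω - θ) 0 ∂P

lemma integrable_directValue (θ : ℝ) : Integrable (fun ω => max (C.R1 0 ω - θ) 0) P :=
  ((C.integrable_R1 0).sub (integrable_const θ)).pos_part

lemma directValue_anti (a b : ℝ) (hab : a ≤ b) : directValue C b ≤ directValue C a :=
  integral_mono (integrable_directValue C b) (integrable_directValue C a) fun ω =>
    max_le_max_right 0 (by linarith)

lemma directValue_le_add (a b : ℝ) (hab : a ≤ b) :
    directValue C a ≤ directValue C b + (b - a) := by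
  have h : ∫ ω, (max (C.R1 0 ω - b) 0 + (b - a)) ∂P = directValue C b + (b - a) := by
    rw [integral_add (integrable_directValue C b) (integrable_const _), directValue]
    simp
  rw [← h]
  refine integral_mono (integrable_directValue C a)
    ((integrable_directValue C b).add (integrable_const _)) fun ω => ?_
  have h1 := le_max_left (C.R1 0 ω - b) 0
  have h2 := le_max_right (C.R1 0 ω - b) 0
  exact max_le (by linarith) (by linarith)

lemma existsUnique_solvesB : ∃! θ, SolvesB C θ := by
  have hk : 0 < c.τ / c.ps := div_pos c.τ_pos c.ps_pos
  have hiff : ∀ θ, SolvesB C θ ↔ directValue C θ = θ * (c.τ / c.ps) := fun θ => by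
    rw [SolvesB, directValue, mul_div_assoc]
  have h0 : 0 < directValue C 0 := by
    simpa [directValue, C.R1_nonneg] using C.integral_R1_pos
  obtain ⟨θ, hθ, h⟩ := exists_eq_mul_of_antitone (fun a b _ => directValue_anti C a b)
    (fun a b _ => directValue_le_add C a b) h0 hk
  refine ⟨θ, (hiff θ).mpr h, fun θ' h' => ?_⟩
  have h' := (hiff θ').mp h'
  -- The equation itself forces the sign, since an expected positive part is nonnegative.
  have hθ' : 0 ≤ θ' := by
    have : 0 ≤ θ' * (c.τ / c.ps) := h'.symm ▸ integral_nonneg fun _ => le_max_right _ _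
    exact nonneg_of_mul_nonneg_left this hk
  exact eq_of_antitone_of_eq_mul (fun a b _ => directValue_anti C a b) hk hθ' hθ.le h' h

lemma roundValue_of_separates {xJ xq θ : ℝ} (hθ : 0 ≤ θ) (h : c.Separates xJ xq θ) :
    (∫ u in Set.Icc xJ xq, c.J θ u 0 ∂C.firstRateLaw) +
      (∫ u in Set.Ioi xq, (u - θ) ∂C.firstRateLaw) = roundValue C θ := by
  have hid : Integrable (fun x : ℝ => x) C.firstRateLaw :=
    (integrable_map_measure (by fun_prop) (C.measurable_R1 0).aemeasurable).mpr (C.integrable_R1 0)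
  have i1 : Integrable (fun u => c.J θ u 0) C.firstRateLaw :=
    (integrable_map_measure (continuous_J c θ).aestronglyMeasurable
      (C.measurable_R1 0).aemeasurable).mpr (integrable_J C hθ 0)
  have i2 : Integrable (fun u => u - θ) C.firstRateLaw := hid.sub (integrable_const θ)
  rw [← integral_indicator measurableSet_Icc, ← integral_indicator measurableSet_Ioi,
    ← integral_add (i1.indicator measurableSet_Icc) (i2.indicator measurableSet_Ioi), roundValue]
  refine integral_congr_ae ?_
  filter_upwards [C.ae_nonneg_firstRateLaw] with x hx
  rw [h.value_eq hx]
  simp only [Set.indicator, Set.mem_Icc, Set.mem_Ioi]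
  split_ifs <;> first | linarith | (exfalso; grind)

/-- The three integral equations are indifference between giving up and probing, indifference
between probing and transmitting, and the balance of the round value. -/
lemma solvesA_iff {xJ xq θ : ℝ} (hcr : c.cr < 1 / (1 - c.τ)) :
    SolvesA C xJ xq θ ↔ 0 < θ ∧ 0 ≤ xJ ∧ xJ ≤ xq ∧ c.J θ xJ 0 = 0 ∧ c.J θ xq 0 = xq - θ ∧
      roundValue C θ = θ * (c.τ / c.ps) := by
  have hτ := c.one_sub_τ_pos
  have hfirst : c.overshoot θ xJ = θ * c.τ / (1 - c.τ) ↔ c.J θ xJ 0 = 0 := by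
    rw [c.J_eq, sub_eq_zero, eq_div_iff hτ.ne', mul_comm (1 - c.τ)]
  have hsecond : 0 ≤ θ → 0 ≤ xq → ((c.cr * (1 - c.τ) - 1) * xq + (1 - c.τ) * (c.Re +
      ∫ u in (0 : ℝ)..θ, c.G u xq) = 0 ↔ c.J θ xq 0 = xq - θ) := fun hθ hxq => by
    rw [c.integral_G hθ, ← c.J_sub_eq θ hxq, sub_eq_zero]
  unfold SolvesA
  rw [c.integral_one_sub_G]
  constructor
  · rintro ⟨hxJ, hle, h1, h2, h3⟩
    -- For `θ ≤ 0` the first equation would have a nonpositive right side, while the overshoot is at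
    -- least `c_r xJ + R_e - θ > 0`.
    have hθ0 : 0 < θ := by
      by_contra! hneg
      have h4 : θ * c.τ / (1 - c.τ) ≤ 0 :=
        div_nonpos_of_nonpos_of_nonneg (mul_nonpos_of_nonpos_of_nonneg hneg c.τ_pos.le) hτ.le
      have h5 := c.le_overshoot θ hxJ
      have h6 := mul_nonneg c.cr_pos.le hxJ
      have h7 := c.Re_pos
      linarith
    have h1 := hfirst.mp h1
    have h2 := (hsecond hθ0.le (hxJ.trans hle)).mp h2
    rw [roundValue_of_separates C hθ0.le (Params.separates_of_eq hcr hθ0.le hxJ hle h1 h2),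
      mul_div_assoc] at h3
    exact ⟨hθ0, hxJ, hle, h1, h2, h3⟩
  · rintro ⟨hθ0, hxJ, hle, h1, h2, h3⟩
    refine ⟨hxJ, hle, hfirst.mpr h1, (hsecond hθ0.le (hxJ.trans hle)).mpr h2, ?_⟩
    rw [roundValue_of_separates C hθ0.le (Params.separates_of_eq hcr hθ0.le hxJ hle h1 h2), h3,
      mul_div_assoc]

/-- The balance alone determines `θ`; for that `θ`, strict monotonicity determines each threshold
separately. -/
lemma solvesA_unique (hcr : c.cr < 1 / (1 - c.τ)) {xJ xq θ xJ' xq' θ' : ℝ}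
    (h : SolvesA C xJ xq θ) (h' : SolvesA C xJ' xq' θ') : xJ = xJ' ∧ xq = xq' ∧ θ = θ' := by
  obtain ⟨hθ, hxJ, hle, hJ, hq, hv⟩ := (solvesA_iff C hcr).mp h
  obtain ⟨hθ', hxJ', hle', hJ', hq', hv'⟩ := (solvesA_iff C hcr).mp h'
  obtain rfl := eq_of_antitone_of_eq_mul (roundValue_anti C) (div_pos c.τ_pos c.ps_pos)
    hθ.le hθ'.le hv hv'
  refine ⟨(c.J_strictMonoOn hθ.le).injOn hxJ hxJ' (hJ.trans hJ'.symm), ?_, rfl⟩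
  refine (Params.J_sub_strictAntiOn hcr θ).injOn (hxJ.trans hle) (hxJ'.trans hle') ?_
  rw [hq, hq', sub_self, sub_self]

lemma strategyA_isOptimal {xJ xq θ : ℝ} (hθ : 0 < θ) (h : c.Separates xJ xq θ)
    (hbal : roundValue C θ = θ * (c.τ / c.ps)) :
    (strategyA C xJ xq θ).IsOptimal C ∧ (strategyA C xJ xq θ).throughput C = θ :=
  (isGreedy_strategyA C h).isOptimal (isMemoryless_strategyA C xJ xq θ).isStationary
    (isMemoryless_strategyA C xJ xq θ).isAdapted hθ (by rw [hbal, mul_div_assoc])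

lemma strategyB_isOptimal {θ : ℝ} (hθ : 0 < θ) (h : ∀ x, 0 ≤ x → c.J θ x 0 ≤ max (x - θ) 0)
    (hbal : roundValue C θ = θ * (c.τ / c.ps)) :
    SolvesB C θ ∧ (strategyB C θ).IsOptimal C ∧ (strategyB C θ).throughput C = θ := by
  refine ⟨?_, (isGreedy_strategyB C h).isOptimal (isMemoryless_strategyB C θ).isStationary
    (isMemoryless_strategyB C θ).isAdapted hθ (by rw [hbal, mul_div_assoc])⟩
  rw [SolvesB, mul_div_assoc, ← hbal, roundValue_eq]
  congr 1
  ext ω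
  rw [max_right_comm, max_eq_left (h _ (C.R1_nonneg 0 ω))]

lemma exists_optimal (hcr : c.cr < 1 / (1 - c.τ))
    (hJ : c.Re / optThroughput C * Real.exp (-(optThroughput C / c.Re)) < c.τ / (1 - c.τ)) :
    (∃ xJ xq θA : ℝ, SolvesA C xJ xq θA ∧ (strategyA C xJ xq θA).IsOptimal C ∧
        (strategyA C xJ xq θA).throughput C = θA) ∨
      (∃ θB : ℝ, SolvesB C θB ∧ (strategyB C θB).IsOptimal C ∧
        (strategyB C θB).throughput C = θB) := by
  obtain ⟨θ, hθ, hbal⟩ := exists_balance C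
  obtain ⟨xq, hxq, hq⟩ := Params.exists_J_eq_sub hcr hθ.le
  -- The hypothesis concerns `θ*`, not yet known to equal `θ`. If the claim failed, the strategy
  -- with `xJ = 0` would be optimal with throughput `θ`, so `θ* = θ` and the hypothesis would give
  -- the claim after all.
  have hneg : c.J θ 0 0 < 0 := by
    by_contra! hnonneg
    obtain ⟨hopt, hthr⟩ := strategyA_isOptimal C hθ
      (Params.separates_zero hcr hθ.le hxq hnonneg hq) hbal
    rw [hopt.optThroughput_eq, hthr] at hJ
    exact absurd (Params.J_zero_neg hθ hJ) hnonneg.not_gt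
  obtain ⟨xJ, hxJ, hxJ0⟩ := Params.exists_J_eq_zero hθ.le hneg.le
  rcases le_or_gt xJ xq with hle | hlt
  · exact Or.inl ⟨xJ, xq, θ, (solvesA_iff C hcr).mpr ⟨hθ, hxJ, hle, hxJ0, hq, hbal⟩,
      strategyA_isOptimal C hθ (Params.separates_of_eq hcr hθ.le hxJ hle hxJ0 hq) hbal⟩
  -- With `xq < xJ`, transmitting is at least as good as probing at all rates from `xJ` on, and
  -- giving up is better than probing below `xJ`.
  · refine Or.inr ⟨θ, strategyB_isOptimal C hθ (fun x hx => ?_) hbal⟩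
    rcases le_or_gt xJ x with h | h
    · exact le_max_of_le_left (Params.le_sub_of_gt hcr hxq hq (hlt.trans_le h))
    · refine le_max_of_le_right ?_
      have := c.J_strictMonoOn hθ.le hx hxJ h
      dsimp only at this
      linarith

end Strategy
end TwoLevelDOS

theorem theorem1 (c : TwoLevelDOS.Params) {Ω : Type*} [MeasurableSpace Ω] (P : Measure Ω)
    [IsProbabilityMeasure P] (C : TwoLevelDOS.Channel c P)
    (hcr : c.cr < 1 / (1 - c.τ))
    (hJ : c.Re / TwoLevelDOS.optThroughput C * Real.exp (-(TwoLevelDOS.optThroughput C / c.Re))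
      < c.τ / (1 - c.τ)) :
    (∀ xJ xq θ xJ' xq' θ' : ℝ, TwoLevelDOS.SolvesA C xJ xq θ → TwoLevelDOS.SolvesA C xJ' xq' θ' →
      xJ = xJ' ∧ xq = xq' ∧ θ = θ') ∧
    (∃! θ : ℝ, TwoLevelDOS.SolvesB C θ) ∧
    ((∃ xJ xq θA : ℝ, TwoLevelDOS.SolvesA C xJ xq θA ∧
        (TwoLevelDOS.strategyA C xJ xq θA).IsOptimal C ∧
        (TwoLevelDOS.strategyA C xJ xq θA).throughput C = θA) ∨
      (∃ θB : ℝ, TwoLevelDOS.SolvesB C θB ∧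
        (TwoLevelDOS.strategyB C θB).IsOptimal C ∧
        (TwoLevelDOS.strategyB C θB).throughput C = θB)) :=
  ⟨fun _ _ _ _ _ _ h h' => TwoLevelDOS.Strategy.solvesA_unique C hcr h h',
    TwoLevelDOS.Strategy.existsUnique_solvesB C, TwoLevelDOS.Strategy.exists_optimal C hcr hJ⟩
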